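/- Let $F$ be a non-archimedean local field with ring of integers $\mathfrak o$ and maximal ideal $\mathfrak p$, let $G=\mathrm{PGL}(2,F)$ with its usual topology, $T\subset G$ the diagonal torus, and $X$ the Bruhat--Tits tree of $G$ (vertices: homothety classes of $\mathfrak o$-lattices in $F^2$; $[L]$ and $[L']$ are adjacent if representatives can be chosen with $\mathfrak pL\subsetneq L'\subsetneq L$). A $k$-path is an injective sequence $(s_0,\dots,s_k)$ of vertices of $X$ with $s_i,s_{i+1}$ adjacent. For $k\ge 0$ let $\tilde X_k$ be the directed graph whose vertices are the $k$-paths and whose edges are the $(k+1)$-paths, the edge $a=(t_0,\dots,t_{k+1})$ having tail $a^-=(t_0,\dots,t_k)$ and head $a^+=(t_1,\dots,t_{k+1})$. Let $C_c^0(\tilde X_k)$ and $C_c^1(\tilde X_k)$ be the spaces of finitely supported complex functions on the vertices and on the edges of $\tilde X_k$, put $df(a)=f(a^+)-f(a^-)$ and $H_c^1(\tilde X_k)=C_c^1(\tilde X_k)/dC_c^0(\tilde X_k)$. Let $\tilde{\mathcal A}$ be the $G$-set of oriented apartments of $X$, i.e. apartments (those attached to the bases $(b_0,b_1)$ of $F^2$,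 spanned by the classes $[\mathfrak o\alpha b_0\oplus\mathfrak o\beta b_1]$, $\alpha,\beta\in F^\times$) together with one of their two coherent orientations. It is a single $G$-orbit, and $T$ is the stabilizer of the standard oriented apartment $\tilde A_{\rm st}$ (vertices $[\mathfrak o e_0\oplus\mathfrak p^n e_1]$, $n\in\mathbb Z$, oriented by increasing $n$), so that $\tilde{\mathcal A}\simeq G/T$; give it the quotient topology, and let $C_c^0(\tilde{\mathcal A})$ be the space of locally constant complex functions with compact support on it. For $\omega\in C_c^1(\tilde X_k)$ and $\tilde A\in\tilde{\mathcal A}$ set $$\mathcal R_k(\omega)(\tilde A)=\sum_{a}\omega(a),$$ the sum being over the $(k+1)$-paths $a$ that are contained in $\tilde A$ and directed compatibly with its orientation. All these spaces carry the natural action of $G$ by translation. Proposition. For every $k\ge 0$, $\mathcal R_k$ takes its values in $C_c^0(\tilde{\mathcal A})$, and: (a) for every $k\ge0$ the sequence of $G$-modules and $G$-equivariant maps $$C_c^0(\tilde X_k)\xrightarrow{\ d\ }C_c^1(\tilde X_k)\xrightarrow{\ \mathcal R_k\ }C_c^0(\tilde{\mathcal A})$$ is exact (at the middle term). In other words, $\mathcal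 R_k$ induces an injective $G$-equivariant map $\bar{\mathcal R}_k: H_c^1(\tilde X_k)\to C_c^0(\tilde{\mathcal A})$. Moreover $f\mapsto\big(g\mapsto f(g\tilde A_{\rm st})\big)$ is an isomorphism of $G$-modules from $C_c^0(\tilde{\mathcal A})$ onto the compactly induced representation $\operatorname{c-ind}_T^G 1_T$, so that $H_c^1(\tilde X_k)$ embeds $G$-equivariantly in $\operatorname{c-ind}_T^G 1_T$. Here $\operatorname{c-ind}_T^G 1_T$ is the space of functions on $G$ that are right $T$-invariant, left invariant under some open subgroup and supported in $CT$ for some compact $C\subset G$, with $G$ acting by left translations. (b) $\displaystyle\bigcup_{k\ge 0}\bar{\mathcal R}_k\big(H_c^1(\tilde X_k)\big)=C_c^0(\tilde{\mathcal A})$. -/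

import Mathlib

open scoped Pointwise MatrixGroups ValuativeRel

noncomputable section

namespace BTTree

/-! ### The Bruhat–Tits tree of `PGL(2, F)` -/

section Tree

variable (F : Type*) [Field F] [ValuativeRel F]

local notation "vv" => ValuativeRel.valuation F

/-- `𝒪`-lattices in `F²`. -/
def Lattice : Type _ := {L : Submodule 𝒪[F] (Fin 2 → F) // L.IsLattice F}

variable {F}

/-- Two lattices are homothetic if they differ by a scalar in `Fˣ`. -/
instance homothety : Setoid (Lattice F) where
  r L L' := ∃ a : Fˣ, L'.1 = a • L.1
  iseqv :=
    { refl := fun _ => ⟨1, (one_smul _ _).symm⟩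
      symm := by
        rintro L L' ⟨a, h⟩
        exact ⟨a⁻¹, by rw [h, inv_smul_smul]⟩
      trans := by
        rintro L L' L'' ⟨a, h⟩ ⟨b, h'⟩
        exact ⟨b * a, by rw [h', h, mul_smul]⟩ }

variable (F) in
/-- Vertices of the tree: homothety classes of lattices in `F²`. -/
def Vertex : Type _ := Quotient (homothety (F := F))

/-- The homothety class of a lattice. -/
def Lattice.toVertex (L : Lattice F) : Vertex F := Quotient.mk _ L

theorem toVertex_eq_iff {L L' : Lattice F} :
    L.toVertex = L'.toVertex ↔ ∃ a : Fˣ, L'.1 = a • L.1 := Quotient.eq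

theorem mem_gl_smul {g : GL (Fin 2) F} {L : Submodule 𝒪[F] (Fin 2 → F)} {x : Fin 2 → F} :
    x ∈ g • L ↔ ∃ v ∈ L, g • v = x := Submodule.mem_smul_pointwise_iff_exists x g L

theorem mem_scalar_smul {a : Fˣ} {L : Submodule 𝒪[F] (Fin 2 → F)} {x : Fin 2 → F} :
    x ∈ a • L ↔ ∃ v ∈ L, a • v = x := Submodule.mem_smul_pointwise_iff_exists x a L

theorem isLattice_gl_smul (g : GL (Fin 2) F) {L : Submodule 𝒪[F] (Fin 2 → F)}
    (hL : L.IsLattice F) : (g • L).IsLattice F where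
  fg := hL.fg.map _
  span_eq_top := by
    have h := Submodule.map_span ((Matrix.GeneralLinearGroup.toLin g).1) (L : Set (Fin 2 → F))
    rw [hL.span_eq_top] at h
    have h2 : Submodule.map (Matrix.GeneralLinearGroup.toLin g).1 ⊤ = ⊤ := by
      rw [Submodule.map_top, LinearMap.range_eq_top]
      exact (LinearMap.GeneralLinearGroup.toLinearEquiv
        (Matrix.GeneralLinearGroup.toLin g)).surjective
    exact h.symm.trans h2

/-- `GL(2, F)` acts on lattices. -/
instance : MulAction (GL (Fin 2) F) (Lattice F) where
  smul g L := ⟨g • L.1, isLattice_gl_smul g L.2⟩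
  one_smul L := Subtype.ext (one_smul _ L.1)
  mul_smul g h L := Subtype.ext (mul_smul g h L.1)

theorem coe_smul_lattice (g : GL (Fin 2) F) (L : Lattice F) : (g • L).1 = g • L.1 := rfl

theorem gl_smul_scalar (g : GL (Fin 2) F) (a : Fˣ) (L : Submodule 𝒪[F] (Fin 2 → F)) :
    g • a • L = a • g • L := by
  ext x
  rw [mem_gl_smul, mem_scalar_smul]
  constructor
  · rintro ⟨_, h, rfl⟩
    obtain ⟨v, hv, rfl⟩ := mem_scalar_smul.1 h
    exact ⟨_, mem_gl_smul.2 ⟨v, hv, rfl⟩, (smul_comm g a v).symm⟩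
  · rintro ⟨_, h, rfl⟩
    obtain ⟨v, hv, rfl⟩ := mem_gl_smul.1 h
    exact ⟨_, mem_scalar_smul.2 ⟨v, hv, rfl⟩, smul_comm g a v⟩

/-- The action of `GL(2, F)` on homothety classes. -/
instance glActionVertex : MulAction (GL (Fin 2) F) (Vertex F) where
  smul g := Quotient.map (fun L => g • L) (by
    rintro L L' ⟨a, h⟩
    exact ⟨a, by rw [coe_smul_lattice, coe_smul_lattice, h, gl_smul_scalar]⟩)
  one_smul x := by
    induction x using Quotient.ind with
    | _ L => exact congrArg _ (one_smul _ L)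
  mul_smul g h x := by
    induction x using Quotient.ind with
    | _ L => exact congrArg _ (mul_smul g h L)

theorem gl_smul_toVertex (g : GL (Fin 2) F) (L : Lattice F) :
    g • L.toVertex = (g • L).toVertex := rfl

/-- The action of `PGL(2, F)` on homothety classes. -/
instance pglActionVertex : MulAction PGL(2, F) (Vertex F) :=
  Matrix.ProjGenLinGroup.mulActionOfGL (by
    intro u x
    induction x using Quotient.ind with
    | _ L =>
      refine toVertex_eq_iff.2 ⟨u⁻¹, ?_⟩
      rw [coe_smul_lattice, eq_inv_smul_iff]
      ext x
      rw [mem_scalar_smul, mem_gl_smul]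
      have : ∀ v : Fin 2 → F, Matrix.GeneralLinearGroup.scalar (Fin 2) u • v = u • v := by
        intro v
        ext i
        simp [Units.smul_def, Matrix.smul_eq_mulVec]
      simp [this])

theorem mk_smul_vertex (g : GL (Fin 2) F) (x : Vertex F) :
    (Matrix.ProjGenLinGroup.mk g : PGL(2, F)) • x = g • x := rfl

theorem scalar_smul_mono {a : Fˣ} {L L' : Submodule 𝒪[F] (Fin 2 → F)} (h : L ≤ L') :
    a • L ≤ a • L' := by
  intro x hx
  obtain ⟨v, hv, rfl⟩ := mem_scalar_smul.1 hx
  exact mem_scalar_smul.2 ⟨v, h hv, rfl⟩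

theorem scalar_smul_strictMono {a : Fˣ} {L L' : Submodule 𝒪[F] (Fin 2 → F)} (h : L < L') :
    a • L < a • L' := by
  refine lt_of_le_not_ge (scalar_smul_mono h.le) fun h' => h.not_ge ?_
  have := scalar_smul_mono (a := a⁻¹) h'
  rwa [inv_smul_smul, inv_smul_smul] at this

theorem smul_le_of_val_le {b c : Fˣ} (L : Submodule 𝒪[F] (Fin 2 → F))
    (hbc : vv (b : F) ≤ vv (c : F)) : b • L ≤ c • L := by
  intro x hx
  obtain ⟨v, hv, rfl⟩ := mem_scalar_smul.1 hx
  have hi : vv ((c : F)⁻¹ * b) ≤ 1 := by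
    rw [map_mul, map_inv₀, inv_mul_le_one₀ (by simp [zero_lt_iff])]
    exact hbc
  refine mem_scalar_smul.2 ⟨(⟨(c : F)⁻¹ * b, hi⟩ : 𝒪[F]) • v, L.smul_mem _ hv, ?_⟩
  ext i
  simp only [Pi.smul_apply, Units.smul_def, Subring.smul_def, smul_eq_mul]
  rw [← mul_assoc, mul_inv_cancel_left₀ c.ne_zero]

theorem gl_smul_mono (g : GL (Fin 2) F) {L L' : Submodule 𝒪[F] (Fin 2 → F)} (h : L ≤ L') :
    g • L ≤ g • L' := by
  intro x hx
  obtain ⟨v, hv, rfl⟩ := mem_gl_smul.1 hx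
  exact mem_gl_smul.2 ⟨v, h hv, rfl⟩

theorem gl_smul_strictMono (g : GL (Fin 2) F) {L L' : Submodule 𝒪[F] (Fin 2 → F)} (h : L < L') :
    g • L < g • L' := by
  refine lt_of_le_not_ge (gl_smul_mono g h.le) fun h' => h.not_ge ?_
  have := gl_smul_mono g⁻¹ h'
  rwa [inv_smul_smul, inv_smul_smul] at this

/-- The apartments of the tree: for a basis `(b₀, b₁)` of `F²`, the (full) subcomplex spanned by the
classes of the lattices having an `𝒪`-basis of the form `(α b₀, β b₁)`, `α, β ∈ Fˣ`.
It is given by its set of vertices. -/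
def IsApartment (A : Set (Vertex F)) : Prop :=
  ∃ b : Module.Basis (Fin 2) F (Fin 2 → F), A = {x | ∃ L : Lattice F, L.toVertex = x ∧
    ∃ α β : Fˣ, L.1 = Submodule.span 𝒪[F] {α • b 0, β • b 1}}

theorem isApartment_smul (g : PGL(2, F)) {A : Set (Vertex F)} (h : IsApartment A) :
    IsApartment (g • A) := by
  induction g using Matrix.ProjGenLinGroup.induction_on with
  | mk g =>
    obtain ⟨b, rfl⟩ := h
    have hspan : ∀ (g : GL (Fin 2) F) (u w : Fin 2 → F) (α β : Fˣ),
        g • Submodule.span 𝒪[F] {α • u, β • w} =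
          Submodule.span 𝒪[F] {α • g • u, β • g • w} := by
      intro g u w α β
      refine (Submodule.map_span _ _).trans ?_
      rw [Set.image_pair]
      exact congrArg _ (congrArg₂ _ (smul_comm g α u) (congrArg _ (smul_comm g β w)))
    let b' : Module.Basis (Fin 2) F (Fin 2 → F) :=
      b.map (LinearMap.GeneralLinearGroup.toLinearEquiv (Matrix.GeneralLinearGroup.toLin g))
    have hb : ∀ i, b' i = g • b i := fun i => rfl
    refine ⟨b', ?_⟩
    ext x
    rw [Set.mem_smul_set_iff_inv_smul_mem, ← map_inv, mk_smul_vertex]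
    constructor
    · rintro ⟨L, hL, α, β, h⟩
      refine ⟨g • L, ?_, α, β, ?_⟩
      · rw [← gl_smul_toVertex, hL, smul_inv_smul]
      · rw [coe_smul_lattice, h, hspan, hb, hb]
    · rintro ⟨L, rfl, α, β, h⟩
      refine ⟨g⁻¹ • L, rfl, α, β, ?_⟩
      rw [coe_smul_lattice, h, hspan, hb, hb, inv_smul_smul, inv_smul_smul]

end Tree

/-! ### Adjacency, apartments, orientations -/

section Building

variable {F : Type*} [Field F] [ValuativeRel F] [TopologicalSpace F] [IsNonarchimedeanLocalField F]

local notation "vv" => ValuativeRel.valuation F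


variable (F) in
theorem exists_uniformizer : ∃ ϖ : Fˣ, ∃ p : 𝒪[F], (p : F) = ϖ ∧ Irreducible p := by
  obtain ⟨p, hp⟩ := IsDiscreteValuationRing.exists_irreducible 𝒪[F]
  have h0 : (p : F) ≠ 0 := fun h => hp.ne_zero (Subtype.ext h)
  exact ⟨Units.mk0 p h0, p, rfl, hp⟩

variable (F) in
/-- A fixed uniformizer of `F`. -/
def unif : Fˣ := (exists_uniformizer F).choose

theorem unif_spec : ∃ p : 𝒪[F], (p : F) = unif F ∧ Irreducible p :=
  (exists_uniformizer F).choose_spec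

theorem val_unif_lt_one : vv (unif F : F) < 1 := by
  obtain ⟨p, hp, hi⟩ := unif_spec (F := F)
  have h1 : vv (unif F : F) ≤ 1 := hp ▸ p.2
  refine lt_of_le_of_ne h1 fun h => hi.not_isUnit ?_
  exact (Valuation.integer.integers vv).isUnit_iff_valuation_eq_one.2 (by
    rw [← h, ← hp]; rfl)

theorem maximalIdeal_smul (L : Submodule 𝒪[F] (Fin 2 → F)) : 𝓂[F] • L = unif F • L := by
  obtain ⟨p, hp, hi⟩ := unif_spec (F := F)
  rw [hi.maximalIdeal_eq, Submodule.ideal_span_singleton_smul]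
  ext x
  rw [mem_scalar_smul, Submodule.mem_smul_pointwise_iff_exists]
  have : ∀ v : Fin 2 → F, p • v = unif F • v := by
    intro v
    ext i
    simp [Units.smul_def, ← hp, Subring.smul_def]
  simp only [this]

theorem exists_val_eq_zpow (a : Fˣ) : ∃ n : ℤ, vv (a : F) = vv (unif F : F) ^ n := by
  obtain ⟨p, hp, hi⟩ := unif_spec (F := F)
  have key : ∀ x : F, x ≠ 0 → vv x ≤ 1 → ∃ n : ℕ, vv x = vv (unif F : F) ^ n := by
    intro x hx h1
    obtain ⟨n, u, hu⟩ := IsDiscreteValuationRing.eq_unit_mul_pow_irreducible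
      (x := (⟨x, h1⟩ : 𝒪[F])) (fun h => hx (congrArg Subtype.val h)) hi
    refine ⟨n, ?_⟩
    have h2 : x = ((u : 𝒪[F]) : F) * (p : F) ^ n := by
      have := congrArg Subtype.val hu
      simpa using this
    have h3 : vv ((u : 𝒪[F]) : F) = 1 :=
      (Valuation.integer.integers vv).isUnit_iff_valuation_eq_one.1 u.isUnit
    rw [h2, map_mul, map_pow, h3, one_mul, hp]
  rcases le_total (vv (a : F)) 1 with h | h
  · obtain ⟨n, hn⟩ := key a a.ne_zero h
    exact ⟨n, by rw [hn, zpow_natCast]⟩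
  · obtain ⟨n, hn⟩ := key (a : F)⁻¹ (inv_ne_zero a.ne_zero) (by
      rw [map_inv₀]
      exact inv_le_one_of_one_le₀ h)
    refine ⟨-n, ?_⟩
    rw [map_inv₀] at hn
    rw [zpow_neg, zpow_natCast, ← hn, inv_inv]

theorem val_zpow_le_iff {m n : ℤ} : vv (unif F : F) ^ m ≤ vv (unif F : F) ^ n ↔ n ≤ m :=
  zpow_le_zpow_iff_right_of_lt_one₀ (by simp [zero_lt_iff]) val_unif_lt_one

variable (F) in
/-- The tree `X`: two classes are adjacent if they have representatives with
`𝔪 L ⊊ L' ⊊ L`. -/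
def tree : SimpleGraph (Vertex F) where
  Adj x y := ∃ L L' : Lattice F, L.toVertex = x ∧ L'.toVertex = y ∧
    𝓂[F] • L.1 < L'.1 ∧ L'.1 < L.1
  symm := ⟨by
    rintro x y ⟨L, L', rfl, rfl, h1, h2⟩
    have hL : (𝓂[F] • L.1).IsLattice F := by
      rw [maximalIdeal_smul]
      have := L.2
      infer_instance
    refine ⟨L', ⟨𝓂[F] • L.1, hL⟩, rfl, ?_, ?_, h1⟩
    · exact toVertex_eq_iff.2 ⟨(unif F)⁻¹, by
        rw [eq_inv_smul_iff]; exact (maximalIdeal_smul _).symm⟩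
    · show 𝓂[F] • L'.1 < 𝓂[F] • L.1
      rw [maximalIdeal_smul, maximalIdeal_smul]
      exact scalar_smul_strictMono h2⟩
  loopless := ⟨by
    rintro x ⟨L, L', h, h', h1, h2⟩
    obtain ⟨a, ha⟩ := toVertex_eq_iff.1 (h.trans h'.symm)
    rw [maximalIdeal_smul] at h1
    obtain ⟨n, hn⟩ := exists_val_eq_zpow a
    rcases le_or_gt n 0 with h0 | h0
    · have := smul_le_of_val_le L.1 (b := 1) (c := a) (by
        rw [hn, Units.val_one, map_one, ← zpow_zero (vv (unif F : F))]
        exact val_zpow_le_iff.2 h0)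
      rw [one_smul, ← ha] at this
      exact h2.not_ge this
    · have := smul_le_of_val_le L.1 (b := a) (c := unif F) (by
        rw [hn]
        conv_rhs => rw [← zpow_one (vv (unif F : F))]
        exact val_zpow_le_iff.2 h0)
      rw [← ha] at this
      exact h1.not_ge this⟩

/-- `dir` is an orientation of the apartment `A`: every edge of `A` is given exactly one direction
(`dir x y` means that the edge `{x, y}` points from `x` to `y`), and the directions are
coherent, i.e. no vertex is the tail of two edges or the head of two edges. -/
structure IsOrientation (A : Set (Vertex F)) (dir : Vertex F → Vertex F → Prop) : Prop where
  edge : ∀ {x y}, dir x y → x ∈ A ∧ y ∈ A ∧ (tree F).Adj x y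
  total : ∀ {x y}, x ∈ A → y ∈ A → (tree F).Adj x y → dir x y ∨ dir y x
  asymm : ∀ {x y}, dir x y → ¬ dir y x
  head_unique : ∀ {x y y'}, dir x y → dir x y' → y = y'
  tail_unique : ∀ {x x' y}, dir x y → dir x' y → x = x'

variable (F) in
/-- Oriented apartments `(A, ε)` of the tree. -/
@[ext]
structure OrientedApartment where
  /-- the vertices of the apartment -/
  verts : Set (Vertex F)
  /-- the orientation -/
  dir : Vertex F → Vertex F → Prop
  isApartment : IsApartment verts
  isOrientation : IsOrientation verts dir

/-! The standard apartment -/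

variable (F) in
/-- The standard lattices `𝒪 e₀ ⊕ 𝔭ⁿ e₁`. -/
def stdSub (n : ℤ) : Submodule 𝒪[F] (Fin 2 → F) :=
  Submodule.span 𝒪[F] {Pi.single 0 1, unif F ^ n • Pi.single 1 1}

theorem mem_stdSub {n : ℤ} {v : Fin 2 → F} :
    v ∈ stdSub F n ↔ vv (v 0) ≤ 1 ∧ vv (v 1) ≤ vv (unif F : F) ^ n := by
  have hne : (unif F : F) ^ n ≠ 0 := zpow_ne_zero _ (unif F).ne_zero
  rw [stdSub, Submodule.mem_span_pair]
  constructor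
  · rintro ⟨a, b, rfl⟩
    have ha : vv (a : F) ≤ 1 := a.2
    have hb : vv (b : F) ≤ 1 := b.2
    refine ⟨by simpa [Units.smul_def, Subring.smul_def] using ha, ?_⟩
    simpa [Units.smul_def, Subring.smul_def] using mul_le_of_le_one_left' hb
  · rintro ⟨h0, h1⟩
    have h1' : vv (v 1 * (unif F : F) ^ (-n)) ≤ 1 := by
      have hpos : 0 < vv (unif F : F) ^ n := zpow_pos (by simp [zero_lt_iff]) _
      rw [map_mul, map_zpow₀, zpow_neg, mul_inv_le_iff₀ hpos, one_mul]
      exact h1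
    refine ⟨⟨v 0, h0⟩, ⟨v 1 * (unif F : F) ^ (-n), h1'⟩, ?_⟩
    ext i
    fin_cases i
    · simp [Units.smul_def, Subring.smul_def]
    · simp [Units.smul_def, Subring.smul_def, inv_mul_cancel_right₀ hne]

theorem mem_scalar_smul_stdSub {a : Fˣ} {j n : ℤ} (ha : vv (a : F) = vv (unif F : F) ^ j)
    {v : Fin 2 → F} : v ∈ a • stdSub F n ↔
      vv (v 0) ≤ vv (unif F : F) ^ j ∧ vv (v 1) ≤ vv (unif F : F) ^ (j + n) := by
  have h0 : vv (unif F : F) ≠ 0 := by simp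
  have hpos : 0 < vv (unif F : F) ^ j := zpow_pos (by simp [zero_lt_iff]) _
  rw [mem_scalar_smul]
  constructor
  · rintro ⟨w, hw, rfl⟩
    obtain ⟨h1, h2⟩ := mem_stdSub.1 hw
    simp only [Pi.smul_apply, Units.smul_def, smul_eq_mul, map_mul, ha]
    rw [zpow_add₀ h0]
    exact ⟨mul_le_of_le_one_right' h1, mul_le_mul_right h2 _⟩
  · rintro ⟨h1, h2⟩
    refine ⟨a⁻¹ • v, mem_stdSub.2 ?_, smul_inv_smul a v⟩
    simp only [Pi.smul_apply, Units.smul_def, smul_eq_mul, map_mul, Units.val_inv_eq_inv_val,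
      map_inv₀, ha]
    refine ⟨(inv_mul_le_one₀ hpos).2 h1, (inv_mul_le_iff₀ hpos).2 ?_⟩
    rwa [← zpow_add₀ h0]

theorem isLattice_stdSub (n : ℤ) : (stdSub F n).IsLattice F where
  fg := Submodule.fg_span (by simp)
  span_eq_top := by
    rw [eq_top_iff]
    intro v _
    have h0 : (Pi.single 0 1 : Fin 2 → F) ∈ Submodule.span F (stdSub F n : Set (Fin 2 → F)) :=
      Submodule.subset_span (Submodule.subset_span (by simp))
    have h1 : (unif F ^ n • Pi.single 1 1 : Fin 2 → F) ∈
        Submodule.span F (stdSub F n : Set (Fin 2 → F)) :=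
      Submodule.subset_span (Submodule.subset_span (by simp))
    have := Submodule.add_mem _ (Submodule.smul_mem _ (v 0) h0)
      (Submodule.smul_mem _ (v 1 * (unif F : F) ^ (-n)) h1)
    convert this using 1
    ext i
    have hne : (unif F : F) ^ n ≠ 0 := zpow_ne_zero _ (unif F).ne_zero
    fin_cases i
    · simp [Units.smul_def]
    · simp [Units.smul_def, inv_mul_cancel_right₀ hne]

variable (F) in
/-- The standard lattices, as elements of `Lattice F`. -/
def stdLattice (n : ℤ) : Lattice F := ⟨stdSub F n, isLattice_stdSub n⟩

variable (F) in
/-- The vertices `[𝒪 e₀ ⊕ 𝔭ⁿ e₁]` of the standard apartment. -/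
def stdVertex (n : ℤ) : Vertex F := (stdLattice F n).toVertex

theorem scalar_smul_stdSub {a : Fˣ} {j : ℤ} (ha : vv (a : F) = vv (unif F : F) ^ j) (n : ℤ) :
    a • stdSub F n = unif F ^ j • stdSub F n := by
  ext v
  rw [mem_scalar_smul_stdSub ha, mem_scalar_smul_stdSub (j := j) (by simp)]

theorem unif_smul_stdSub_le {i j m n : ℤ} :
    unif F ^ i • stdSub F m ≤ unif F ^ j • stdSub F n ↔ j ≤ i ∧ j + n ≤ i + m := by
  have hv : ∀ i : ℤ, vv ((unif F ^ i : Fˣ) : F) = vv (unif F : F) ^ i := by simp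
  constructor
  · intro h
    constructor
    · have := h ((mem_scalar_smul_stdSub (hv i) (n := m)
        (v := Pi.single 0 ((unif F : F) ^ i))).2 (by simp))
      have := ((mem_scalar_smul_stdSub (hv j)).1 this).1
      exact val_zpow_le_iff.1 (by simpa using this)
    · have := h ((mem_scalar_smul_stdSub (hv i) (n := m)
        (v := Pi.single 1 ((unif F : F) ^ (i + m)))).2 (by simp))
      have := ((mem_scalar_smul_stdSub (hv j)).1 this).2
      exact val_zpow_le_iff.1 (by simpa using this)
  · rintro ⟨h1, h2⟩ v hv'
    rw [mem_scalar_smul_stdSub (hv _)] at hv' ⊢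
    exact ⟨hv'.1.trans (val_zpow_le_iff.2 h1), hv'.2.trans (val_zpow_le_iff.2 h2)⟩

theorem stdVertex_injective : Function.Injective (stdVertex F) := by
  intro m n h
  obtain ⟨a, ha⟩ := toVertex_eq_iff.1 h
  obtain ⟨j, hj⟩ := exists_val_eq_zpow a
  have h2 : stdSub F n = a • stdSub F m := ha
  rw [scalar_smul_stdSub hj, ← one_smul Fˣ (stdSub F n), ← zpow_zero (unif F)] at h2
  have h3 := unif_smul_stdSub_le.1 h2.le
  have h4 := unif_smul_stdSub_le.1 h2.ge
  omega

theorem stdVertex_adj_iff {m n : ℤ} :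
    (tree F).Adj (stdVertex F m) (stdVertex F n) ↔ n = m + 1 ∨ m = n + 1 := by
  have main : ∀ m n : ℤ, n = m + 1 → (tree F).Adj (stdVertex F m) (stdVertex F n) := by
    rintro m n rfl
    refine ⟨stdLattice F m, stdLattice F (m + 1), rfl, rfl, ?_, ?_⟩
    · show 𝓂[F] • stdSub F m < stdSub F (m + 1)
      rw [maximalIdeal_smul, ← one_smul Fˣ (stdSub F (m + 1)), ← zpow_zero (unif F)]
      conv_lhs => rw [← zpow_one (unif F)]
      rw [lt_iff_le_not_ge, unif_smul_stdSub_le, unif_smul_stdSub_le]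
      omega
    · show stdSub F (m + 1) < stdSub F m
      rw [← one_smul Fˣ (stdSub F (m + 1)), ← one_smul Fˣ (stdSub F m), ← zpow_zero (unif F)]
      rw [lt_iff_le_not_ge, unif_smul_stdSub_le, unif_smul_stdSub_le]
      omega
  constructor
  · rintro ⟨L, L', h, h', h1, h2⟩
    obtain ⟨a, ha⟩ := toVertex_eq_iff.1 h.symm
    obtain ⟨b, hb⟩ := toVertex_eq_iff.1 h'.symm
    obtain ⟨i, hi⟩ := exists_val_eq_zpow a
    obtain ⟨j, hj⟩ := exists_val_eq_zpow b
    have ha' : L.1 = unif F ^ i • stdSub F m := ha.trans (scalar_smul_stdSub hi m)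
    have hb' : L'.1 = unif F ^ j • stdSub F n := hb.trans (scalar_smul_stdSub hj n)
    rw [maximalIdeal_smul, ha', hb', smul_smul, ← zpow_one_add, lt_iff_le_not_ge,
      unif_smul_stdSub_le, unif_smul_stdSub_le] at h1
    rw [ha', hb', lt_iff_le_not_ge, unif_smul_stdSub_le, unif_smul_stdSub_le] at h2
    omega
  · rintro (h | h)
    · exact main m n h
    · exact (main n m h).symm

variable (F) in
/-- The standard oriented apartment: the vertices `[𝒪 e₀ ⊕ 𝔭ⁿ e₁]`, `n ∈ ℤ`, oriented by
increasing `n`. -/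
def stdApartment : OrientedApartment F where
  verts := Set.range (stdVertex F)
  dir x y := ∃ n : ℤ, x = stdVertex F n ∧ y = stdVertex F (n + 1)
  isApartment := by
    refine ⟨Pi.basisFun F (Fin 2), ?_⟩
    ext x
    simp only [Pi.basisFun_apply]
    constructor
    · rintro ⟨n, rfl⟩
      exact ⟨stdLattice F n, rfl, 1, unif F ^ n, by simp [stdLattice, stdSub]⟩
    · rintro ⟨L, rfl, α, β, h⟩
      obtain ⟨n, hn⟩ := exists_val_eq_zpow (α⁻¹ * β)
      refine ⟨n, toVertex_eq_iff.2 ⟨α, ?_⟩⟩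
      rw [h]
      obtain ⟨i, hi⟩ := exists_val_eq_zpow α
      have hj : vv (β : F) = vv (unif F : F) ^ (i + n) := by
        rw [zpow_add₀ (by simp), ← hi, ← hn]
        simp
      show _ = α • stdSub F n
      ext v
      rw [mem_scalar_smul_stdSub hi, Submodule.mem_span_pair]
      have hpos : ∀ k : ℤ, 0 < vv (unif F : F) ^ k := fun k =>
        zpow_pos (by simp [zero_lt_iff]) _
      constructor
      · rintro ⟨a, b, rfl⟩
        have ha : vv (a : F) ≤ 1 := a.2
        have hb : vv (b : F) ≤ 1 := b.2
        constructor
        · simpa [Units.smul_def, Subring.smul_def, hi] using mul_le_of_le_one_left' ha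
        · simpa [Units.smul_def, Subring.smul_def, hj] using mul_le_of_le_one_left' hb
      · rintro ⟨h0, h1⟩
        refine ⟨⟨v 0 * (α : F)⁻¹, ?_⟩, ⟨v 1 * (β : F)⁻¹, ?_⟩, ?_⟩
        · show vv _ ≤ 1
          rw [map_mul, map_inv₀, hi, mul_inv_le_iff₀ (hpos _), one_mul]
          exact h0
        · show vv _ ≤ 1
          rw [map_mul, map_inv₀, hj, mul_inv_le_iff₀ (hpos _), one_mul]
          exact h1
        · ext i
          fin_cases i <;> simp [Units.smul_def, Subring.smul_def]
  isOrientation :=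
    { edge := by
        rintro _ _ ⟨n, rfl, rfl⟩
        exact ⟨⟨n, rfl⟩, ⟨n + 1, rfl⟩, stdVertex_adj_iff.2 (Or.inl rfl)⟩
      total := by
        rintro _ _ ⟨m, rfl⟩ ⟨n, rfl⟩ h
        rcases stdVertex_adj_iff.1 h with rfl | rfl
        · exact Or.inl ⟨m, rfl, rfl⟩
        · exact Or.inr ⟨n, rfl, rfl⟩
      asymm := by
        rintro _ _ ⟨m, rfl, rfl⟩ ⟨n, h1, h2⟩
        have h1 := stdVertex_injective h1
        have h2 := stdVertex_injective h2
        omega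
      head_unique := by
        rintro _ _ _ ⟨m, rfl, rfl⟩ ⟨n, h1, rfl⟩
        rw [stdVertex_injective h1]
      tail_unique := by
        rintro _ _ _ ⟨m, rfl, rfl⟩ ⟨n, rfl, h2⟩
        have := stdVertex_injective h2
        rw [show m = n by omega] }

/-! ### The action of `PGL(2, F)` on the tree and on oriented apartments -/

theorem tree_adj_smul (g : PGL(2, F)) {x y : Vertex F} (h : (tree F).Adj x y) :
    (tree F).Adj (g • x) (g • y) := by
  induction g using Matrix.ProjGenLinGroup.induction_on with
  | mk g =>
    obtain ⟨L, L', rfl, rfl, h1, h2⟩ := h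
    refine ⟨g • L, g • L', rfl, rfl, ?_, gl_smul_strictMono g h2⟩
    rw [coe_smul_lattice, coe_smul_lattice, maximalIdeal_smul, ← gl_smul_scalar,
      ← maximalIdeal_smul]
    exact gl_smul_strictMono g h1

theorem tree_adj_smul_iff (g : PGL(2, F)) {x y : Vertex F} :
    (tree F).Adj (g • x) (g • y) ↔ (tree F).Adj x y :=
  ⟨fun h => by simpa using tree_adj_smul g⁻¹ h, tree_adj_smul g⟩

/-- `g.(A, ε) = (gA, gε)`. -/
instance : MulAction PGL(2, F) (OrientedApartment F) where
  smul g A :=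
    { verts := g • A.verts
      dir := fun x y => A.dir (g⁻¹ • x) (g⁻¹ • y)
      isApartment := isApartment_smul g A.isApartment
      isOrientation :=
        { edge := fun h => by
            obtain ⟨h1, h2, h3⟩ := A.isOrientation.edge h
            exact ⟨Set.mem_smul_set_iff_inv_smul_mem.2 h1,
              Set.mem_smul_set_iff_inv_smul_mem.2 h2, (tree_adj_smul_iff g⁻¹).1 h3⟩
          total := fun h1 h2 h3 =>
            A.isOrientation.total (Set.mem_smul_set_iff_inv_smul_mem.1 h1)
              (Set.mem_smul_set_iff_inv_smul_mem.1 h2) (tree_adj_smul g⁻¹ h3)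
          asymm := fun h => A.isOrientation.asymm h
          head_unique := fun h h' => (MulAction.injective g⁻¹) (A.isOrientation.head_unique h h')
          tail_unique := fun h h' =>
            (MulAction.injective g⁻¹) (A.isOrientation.tail_unique h h') } }
  one_smul A := by
    refine OrientedApartment.ext (one_smul _ A.verts) ?_
    funext x y
    show A.dir ((1 : PGL(2, F))⁻¹ • x) ((1 : PGL(2, F))⁻¹ • y) = _
    rw [inv_one, one_smul, one_smul]
  mul_smul g h A := by
    refine OrientedApartment.ext (mul_smul g h A.verts) ?_
    funext x y
    show A.dir ((g * h)⁻¹ • x) ((g * h)⁻¹ • y) = A.dir (h⁻¹ • g⁻¹ • x) (h⁻¹ • g⁻¹ • y)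
    rw [mul_inv_rev, mul_smul, mul_smul]

theorem mem_smul_verts (g : PGL(2, F)) (A : OrientedApartment F) (x : Vertex F) :
    x ∈ (g • A).verts ↔ g⁻¹ • x ∈ A.verts := Set.mem_smul_set_iff_inv_smul_mem

theorem smul_dir (g : PGL(2, F)) (A : OrientedApartment F) (x y : Vertex F) :
    (g • A).dir x y ↔ A.dir (g⁻¹ • x) (g⁻¹ • y) := Iff.rfl

variable (F) in
/-- The topology of `PGL(2, F)`: the quotient topology of `GL(2, F)`. -/
instance : TopologicalSpace PGL(2, F) :=
  inferInstanceAs (TopologicalSpace (GL (Fin 2) F ⧸ Subgroup.center (GL (Fin 2) F)))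

instance : IsTopologicalGroup PGL(2, F) :=
  inferInstanceAs (IsTopologicalGroup (GL (Fin 2) F ⧸ Subgroup.center (GL (Fin 2) F)))

variable (F) in
/-- The diagonal torus `T` of `PGL(2, F)`. -/
def torus : Subgroup PGL(2, F) :=
  (Matrix.ProjGenLinGroup.mk.comp
    (Units.map (Matrix.diagonalRingHom (Fin 2) F).toMonoidHom)).range

/-- The topology of the space of oriented apartments: the quotient topology through the orbit map
`g ↦ g • A_st` of the standard oriented apartment (whose stabilizer is the diagonal torus). -/
instance : TopologicalSpace (OrientedApartment F) :=
  TopologicalSpace.coinduced (fun g : PGL(2, F) => g • stdApartment F) inferInstance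

instance : ContinuousConstSMul PGL(2, F) (OrientedApartment F) where
  continuous_const_smul g := by
    refine continuous_coinduced_dom.2 ?_
    have : (fun A : OrientedApartment F => g • A) ∘ (fun h : PGL(2, F) => h • stdApartment F) =
        (fun h : PGL(2, F) => h • stdApartment F) ∘ fun h => g * h := by
      funext h
      exact (mul_smul g h _).symm
    rw [this]
    exact continuous_coinduced_rng.comp (continuous_const_mul g)

/-! ### The directed graphs `X̃_k` -/

/-- The tree is locally finite. -/
theorem finite_neighbors (x : Vertex F) : {y | (tree F).Adj x y}.Finite := by
  induction x using Quotient.ind with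
  | _ L =>
    have hfin : {N : Submodule 𝒪[F] (Fin 2 → F) | 𝓂[F] • L.1 ≤ N ∧ N ≤ L.1}.Finite := by
      have hL : Module.Finite 𝒪[F] L.1 := Module.Finite.iff_fg.2 L.2.fg
      have hQ : Finite (L.1 ⧸ (𝓂[F] • (⊤ : Submodule 𝒪[F] L.1))) := by
        have : Module.Finite (𝒪[F] ⧸ 𝓂[F]) (L.1 ⧸ (𝓂[F] • (⊤ : Submodule 𝒪[F] L.1))) :=
          Module.Finite.of_restrictScalars_finite 𝒪[F] _ _
        have : Finite (𝒪[F] ⧸ 𝓂[F]) := inferInstanceAs (Finite 𝓀[F])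
        exact Module.finite_of_finite (𝒪[F] ⧸ 𝓂[F])
      have hS : Finite (Submodule 𝒪[F] (L.1 ⧸ (𝓂[F] • (⊤ : Submodule 𝒪[F] L.1)))) :=
        Finite.of_injective _ SetLike.coe_injective
      refine Set.Finite.of_surjOn (s := Set.univ)
        (fun M : Submodule 𝒪[F] (L.1 ⧸ (𝓂[F] • (⊤ : Submodule 𝒪[F] L.1))) =>
          (M.comap (Submodule.mkQ _)).map L.1.subtype) ?_ Set.finite_univ
      rintro N ⟨h1, h2⟩
      refine ⟨(N.comap L.1.subtype).map (Submodule.mkQ _), trivial, ?_⟩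
      have hle : 𝓂[F] • (⊤ : Submodule 𝒪[F] L.1) ≤ N.comap L.1.subtype := by
        rw [← Submodule.map_le_iff_le_comap, Submodule.map_smul'', Submodule.map_subtype_top]
        exact h1
      simp only
      rw [Submodule.comap_map_mkQ, sup_eq_right.2 hle, Submodule.map_comap_subtype,
        inf_eq_right.2 h2]
    refine ((hfin.preimage Subtype.val_injective.injOn).image Lattice.toVertex).subset ?_
    rintro y ⟨L₁, L', h, rfl, h1, h2⟩
    obtain ⟨a, ha⟩ := toVertex_eq_iff.1 h
    have ha : L.1 = a • L₁.1 := ha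
    have hL' : (a • L'.1).IsLattice F := by
      have := L'.2
      infer_instance
    refine ⟨⟨a • L'.1, hL'⟩, ⟨?_, ?_⟩, toVertex_eq_iff.2 ⟨a⁻¹, (inv_smul_smul a _).symm⟩⟩
    · rw [ha, maximalIdeal_smul, smul_comm, ← maximalIdeal_smul]
      exact scalar_smul_mono h1.le
    · rw [ha]
      exact scalar_smul_mono h2.le

variable (F) in
/-- `k`-paths: injective sequences `(s₀, …, s_k)` of vertices of `X` with consecutive ones
adjacent. They are the vertices of `X̃_k`; the edges of `X̃_k` are the `(k+1)`-paths. -/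
def KPath (k : ℕ) : Type _ :=
  {s : Fin (k + 1) → Vertex F //
    Function.Injective s ∧ ∀ i : Fin k, (tree F).Adj (s i.castSucc) (s i.succ)}

/-- The head `a⁺ = (t₁, …, t_{k+1})` of the edge `a = (t₀, …, t_{k+1})` of `X̃_k`. -/
def KPath.head {k : ℕ} (a : KPath F (k + 1)) : KPath F k :=
  ⟨fun i => a.1 i.succ, fun _ _ h => Fin.succ_injective _ (a.2.1 h), fun i => a.2.2 i.succ⟩

/-- The tail `a⁻ = (t₀, …, t_k)` of the edge `a = (t₀, …, t_{k+1})` of `X̃_k`. -/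
def KPath.tail {k : ℕ} (a : KPath F (k + 1)) : KPath F k :=
  ⟨fun i => a.1 i.castSucc, fun _ _ h => Fin.castSucc_injective _ (a.2.1 h),
    fun i => a.2.2 i.castSucc⟩

instance (k : ℕ) : MulAction PGL(2, F) (KPath F k) where
  smul g s := ⟨fun i => g • s.1 i, fun _ _ h => s.2.1 (MulAction.injective g h),
    fun i => tree_adj_smul g (s.2.2 i)⟩
  one_smul s := Subtype.ext (funext fun i => one_smul _ (s.1 i))
  mul_smul g h s := Subtype.ext (funext fun i => mul_smul g h (s.1 i))

theorem head_smul {k : ℕ} (g : PGL(2, F)) (a : KPath F (k + 1)) : (g • a).head = g • a.head := rfl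

theorem tail_smul {k : ℕ} (g : PGL(2, F)) (a : KPath F (k + 1)) : (g • a).tail = g • a.tail := rfl

/-- `X̃_k` is locally finite. -/
theorem finite_head_eq {k : ℕ} (s : KPath F k) : {a : KPath F (k + 1) | a.head = s}.Finite := by
  refine Set.Finite.of_finite_image (f := fun a : KPath F (k + 1) => a.1 0)
    ((finite_neighbors (s.1 0)).subset ?_) ?_
  · rintro _ ⟨a, rfl, rfl⟩
    exact (a.2.2 0).symm
  · rintro a ha b hb h
    refine Subtype.ext (funext fun i => ?_)
    induction i using Fin.cases with
    | zero => exact h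
    | succ i =>
      exact congrFun (congrArg Subtype.val (Eq.trans ha (Eq.symm hb))) i

theorem finite_tail_eq {k : ℕ} (s : KPath F k) : {a : KPath F (k + 1) | a.tail = s}.Finite := by
  refine Set.Finite.of_finite_image (f := fun a : KPath F (k + 1) => a.1 (Fin.last _))
    ((finite_neighbors (s.1 (Fin.last _))).subset ?_) ?_
  · rintro _ ⟨a, rfl, rfl⟩
    exact a.2.2 (Fin.last _)
  · rintro a ha b hb h
    refine Subtype.ext (funext fun i => ?_)
    induction i using Fin.lastCases with
    | last => exact h
    | cast i =>
      exact congrFun (congrArg Subtype.val (Eq.trans ha (Eq.symm hb))) i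

/-! ### Cochains with finite support -/

/-- `C_c⁰(X̃_k, ℂ)`: finitely supported functions on the vertices of `X̃_k`. -/
abbrev Cc0 (F : Type*) [Field F] [ValuativeRel F] [TopologicalSpace F]
    [IsNonarchimedeanLocalField F] (k : ℕ) : Type _ := KPath F k →₀ ℂ

/-- `C_c¹(X̃_k, ℂ)`: finitely supported functions on the edges of `X̃_k`. -/
abbrev Cc1 (F : Type*) [Field F] [ValuativeRel F] [TopologicalSpace F]
    [IsNonarchimedeanLocalField F] (k : ℕ) : Type _ := KPath F (k + 1) →₀ ℂ

variable (F) in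
/-- The coboundary `d f (a) = f(a⁺) - f(a⁻)`. -/
def coboundary (k : ℕ) : Cc0 F k →ₗ[ℂ] Cc1 F k where
  toFun f := Finsupp.ofSupportFinite (fun a => f a.head - f a.tail) (by
    have h1 : {a : KPath F (k + 1) | a.head ∈ f.support}.Finite :=
      f.support.finite_toSet.preimage' fun s _ => finite_head_eq s
    have h2 : {a : KPath F (k + 1) | a.tail ∈ f.support}.Finite :=
      f.support.finite_toSet.preimage' fun s _ => finite_tail_eq s
    refine (h1.union h2).subset fun a ha => ?_
    by_contra h
    simp only [Set.mem_union, Set.mem_ofPred_eq, Finsupp.mem_support_iff, not_or, not_not] at h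
    exact ha (by simp [h.1, h.2]))
  map_add' f g := by
    ext a
    show (f + g) a.head - (f + g) a.tail = (f a.head - f a.tail) + (g a.head - g a.tail)
    simp only [Finsupp.add_apply]
    ring
  map_smul' c f := by
    ext a
    show (c • f) a.head - (c • f) a.tail = c * (f a.head - f a.tail)
    simp only [Finsupp.smul_apply, smul_eq_mul]
    ring

theorem coboundary_apply {k : ℕ} (f : Cc0 F k) (a : KPath F (k + 1)) :
    coboundary F k f a = f a.head - f a.tail := rfl

variable (F) in
/-- The action of `PGL(2, F)` on finitely supported functions on `k`-paths,
`(g f)(s) = f(g⁻¹ s)`. -/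
def pathRep (k : ℕ) : Representation ℂ PGL(2, F) (KPath F k →₀ ℂ) where
  toFun g := Finsupp.lmapDomain ℂ ℂ (fun s => g • s)
  map_one' := by
    ext s
    simp
  map_mul' g h := by
    ext s
    simp [mul_smul]

theorem pathRep_apply {k : ℕ} (g : PGL(2, F)) (f : KPath F k →₀ ℂ) (s : KPath F k) :
    pathRep F k g f s = f (g⁻¹ • s) := by
  have := Finsupp.mapDomain_apply (MulAction.injective g) f (g⁻¹ • s)
  rwa [smul_inv_smul] at this

theorem coboundary_pathRep {k : ℕ} (g : PGL(2, F)) (f : Cc0 F k) :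
    coboundary F k (pathRep F k g f) = pathRep F (k + 1) g (coboundary F k f) := by
  ext a
  rw [coboundary_apply, pathRep_apply, pathRep_apply, pathRep_apply, coboundary_apply,
    head_smul, tail_smul]

/-- The cohomology `H_c¹(X̃_k, ℂ) = C_c¹(X̃_k, ℂ) / d C_c⁰(X̃_k, ℂ)`. -/
abbrev Hc1 (F : Type*) [Field F] [ValuativeRel F] [TopologicalSpace F]
    [IsNonarchimedeanLocalField F] (k : ℕ) : Type _ :=
  Cc1 F k ⧸ LinearMap.range (coboundary F k)

variable (F) in
/-- The class in `H_c¹(X̃_k, ℂ)` of a `1`-cochain with finite support. -/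
def Hc1.mk (k : ℕ) : Cc1 F k →ₗ[ℂ] Hc1 F k := Submodule.mkQ _

variable (F) in
/-- The action of `PGL(2, F)` on `H_c¹(X̃_k, ℂ)`, induced by the action on `1`-cochains. -/
def hc1Rep (k : ℕ) : Representation ℂ PGL(2, F) (Hc1 F k) :=
  (pathRep F (k + 1)).quotient (LinearMap.range (coboundary F k)) (by
    rintro g _ ⟨f, rfl⟩
    exact ⟨pathRep F k g f, coboundary_pathRep g f⟩)

theorem hc1Rep_mk {k : ℕ} (g : PGL(2, F)) (ω : Cc1 F k) :
    hc1Rep F k g (Hc1.mk F k ω) = Hc1.mk F k (pathRep F (k + 1) g ω) := rfl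

/-! ### The Radon transform -/

/-- The `k`-paths contained in the oriented apartment `A` whose orientation is compatible with that
of `A`. For `k + 1` in place of `k`, these are the edges of the apartment `Ã_k` of `X̃_k`. -/
def OrientedApartment.paths (A : OrientedApartment F) (k : ℕ) : Set (KPath F k) :=
  {s | (∀ i, s.1 i ∈ A.verts) ∧ ∀ i : Fin k, A.dir (s.1 i.castSucc) (s.1 i.succ)}

variable (F) in
/-- The geodesic Radon transform `R(ω)(Ã) = ∑_{a ∈ Ã¹} ω(a)`, as a function on all oriented
apartments; the sum is finite since `ω` has finite support. -/
def radon (k : ℕ) : Cc1 F k →ₗ[ℂ] (OrientedApartment F → ℂ) where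
  toFun ω A := ∑ᶠ a ∈ A.paths (k + 1), ω a
  map_add' ω η := by
    funext A
    simp only [Finsupp.add_apply, Pi.add_apply]
    exact finsum_mem_add_distrib' (ω.hasFiniteSupport.inter_of_right _)
      (η.hasFiniteSupport.inter_of_right _)
  map_smul' c ω := by
    funext A
    simp only [Finsupp.smul_apply, Pi.smul_apply, RingHom.id_apply]
    rw [smul_finsum]
    exact finsum_congr fun a => (smul_finsum c _).symm

variable (F) in
/-- `C_c⁰(Ã)`: locally constant functions with compact support on the space of oriented
apartments. -/
def CcApt : Submodule ℂ (OrientedApartment F → ℂ) where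
  carrier := {f | IsLocallyConstant f ∧ HasCompactSupport f}
  zero_mem' := ⟨IsLocallyConstant.const 0, HasCompactSupport.zero⟩
  add_mem' hf hg := ⟨hf.1.add hg.1, hf.2.add hg.2⟩
  smul_mem' c _ hf := ⟨hf.1.comp (c • ·), hf.2.smul_left (f := fun _ => c)⟩

variable (F) in
/-- The action of `PGL(2, F)` on `C_c⁰(Ã)`: `(g f)(Ã) = f(g⁻¹ Ã)`. -/
def aptRep : Representation ℂ PGL(2, F) (CcApt F) where
  toFun g :=
    { toFun := fun f => ⟨fun A => f.1 (g⁻¹ • A),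
        f.2.1.comp_continuous (continuous_const_smul g⁻¹),
        f.2.2.comp_homeomorph (Homeomorph.smul g⁻¹)⟩
      map_add' := fun _ _ => rfl
      map_smul' := fun _ _ => rfl }
  map_one' := by
    ext f A
    simp
  map_mul' g h := by
    ext f A
    simp [mul_smul]

/-! ### The compactly induced representation -/

variable (F) in
/-- The space of `cind_T^G 1_T`: functions `f` on `G = PGL(2, F)` which are right invariant under
`T`, left invariant under some open subgroup, and supported in `C T` for some compact `C ⊆ G`. -/
def cind : Submodule ℂ (PGL(2, F) → ℂ) where
  carrier := {f | (∀ g, ∀ t ∈ torus F, f (g * t) = f g) ∧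
    (∃ K : Subgroup PGL(2, F), IsOpen (K : Set PGL(2, F)) ∧ ∀ κ ∈ K, ∀ g, f (κ * g) = f g) ∧
    ∃ C : Set PGL(2, F), IsCompact C ∧ Function.support f ⊆ C * (torus F : Set PGL(2, F))}
  zero_mem' := ⟨fun _ _ _ => rfl, ⟨⊤, isOpen_univ, fun _ _ _ => rfl⟩, ∅, isCompact_empty, by simp⟩
  add_mem' := by
    rintro f f' ⟨h1, ⟨K, hK, h2⟩, C, hC, h3⟩ ⟨h1', ⟨K', hK', h2'⟩, C', hC', h3'⟩
    refine ⟨fun g t ht => ?_, ⟨K ⊓ K', hK.inter hK', fun κ hκ g => ?_⟩, C ∪ C', hC.union hC', ?_⟩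
    · simp [h1 g t ht, h1' g t ht]
    · simp [h2 κ hκ.1 g, h2' κ hκ.2 g]
    · rw [Set.union_mul]
      exact (Function.support_add f f').trans (Set.union_subset_union h3 h3')
  smul_mem' := by
    rintro c f ⟨h1, ⟨K, hK, h2⟩, C, hC, h3⟩
    refine ⟨fun g t ht => ?_, ⟨K, hK, fun κ hκ g => ?_⟩, C, hC, ?_⟩
    · simp [h1 g t ht]
    · simp [h2 κ hκ g]
    · exact (Function.support_const_smul_subset c f).trans h3

variable (F) in
/-- The action of `PGL(2, F)` on `cind_T^G 1_T` by left translations, `(g f)(h) = f(g⁻¹ h)`. -/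
def cindRep : Representation ℂ PGL(2, F) (cind F) where
  toFun g :=
    { toFun := fun f => ⟨fun h => f.1 (g⁻¹ * h), by
        obtain ⟨f, h1, ⟨K, hK, h2⟩, C, hC, h3⟩ := f
        refine ⟨fun h t ht => ?_, ⟨K.comap (MulAut.conj g⁻¹).toMonoidHom, ?_, ?_⟩,
          (fun h => g * h) '' C, hC.image (continuous_const_mul g), ?_⟩
        · show f (g⁻¹ * (h * t)) = f (g⁻¹ * h)
          rw [← mul_assoc, h1 _ t ht]
        · exact hK.preimage (by
            show Continuous fun h => g⁻¹ * h * g⁻¹⁻¹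
            fun_prop)
        · intro κ hκ h
          show f (g⁻¹ * (κ * h)) = f (g⁻¹ * h)
          have := h2 _ hκ (g⁻¹ * h)
          rw [← this]
          simp [mul_assoc]
        · intro h hh
          obtain ⟨c, hc, t, ht, hct⟩ := h3 (show g⁻¹ * h ∈ Function.support f from hh)
          exact ⟨g * c, ⟨c, hc, rfl⟩, t, ht, by
            show g * c * t = h
            have : c * t = g⁻¹ * h := hct
            rw [mul_assoc, this, mul_inv_cancel_left]⟩⟩
      map_add' := fun _ _ => rfl
      map_smul' := fun _ _ => rfl }
  map_one' := by
    ext f h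
    simp
  map_mul' g g' := by
    ext f h
    simp [mul_assoc]

end Building
end BTTree

end

open BTTree

/-!
The proof works with the group `G = PGL(2, F)` and explicit matrices; that `X` is a tree is never
used. Write `σₙ` for the standard `k`-path with vertices `n, …, n + k`. The group acts transitively
on `k`-paths (`exists_smul_stdPath`) and on oriented apartments (`exists_smul_stdApartment`), the
stabilizer of the standard oriented apartment is the torus `T` (`smul_stdApartment_eq_iff`), and the
Radon transform of `ω` at `g A_st` is `∑_{n ∈ ℤ} ω(g σₙ)` (`radon_smul_stdApartment`). Vertex
stabilizers are open and compact, which makes Radon transforms locally constant with compact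
support (`radon_mem_CcApt`).

Exactness. If `R ω = 0`, a primitive of `ω` takes at `g σ₀` the value `∑_{n < 0} ω(g σₙ)`. For this
to depend on the path only, it must be unchanged when `g` is multiplied by an element `u` of the
stabilizer of `σ₀`. It is enough to consider matrices `u` whose lower right entry is a unit. By the
Gauss decomposition, `u = x y` where `x` fixes all vertices `n ≥ 0` and
`y` all vertices `n ≤ k`. The factor `y` does not affect the sum over negative positions; the factor
`x` does not affect the sum over the other positions, which is the opposite one as `R ω = 0`
(`backSum_mul_of_mem_stabilizer`). The primitive has finite support: the matrix `g` can be
chosen so that its first column is not longer than the second one, and then `g σ₋ₘ` can lie in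
the support of `ω` for boundedly many `m` only (`exists_bound_position`,
`finite_support_primitive`).

Surjectivity of the union. Every oriented apartment is `g A_st` for some `g` whose columns have
equal norms, and this `g` is unique up to elements that fix `A_st` pointwise; such balanced `g`
remain balanced under the pointwise stabilizer `K_m` of the vertices `-m, …, m`, for `m ≥ 1`
(`exists_balanced`, `smul_stdVertex_of_balanced`, `mul_mem_balanced`). If `f` is locally constant
with compact support, then for large `m` the function `g ↦ f(g A_st)` is right invariant under
`K_m` on balanced elements. Putting `ω(g σ) = f(g A_st)` for balanced `g`, where `σ` is the standard
path from `-m` to `m`, and `ω = 0` on all other paths, one obtains `R ω = f`, since each oriented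
apartment contains exactly one path `g σ` with `g` balanced (`exists_radon_eq`).
-/

set_option linter.unusedSectionVars false

noncomputable section

namespace BTTree

open Matrix

/-! ### Matrices of size two -/

section Matrices

variable {F : Type*} [Field F]

/-- The upper unipotent matrix with entry `x`. -/
def upper (x : F) : GL (Fin 2) F where
  val := !![1, x; 0, 1]
  inv := !![1, -x; 0, 1]
  val_inv := by simp [Matrix.one_fin_two]
  inv_val := by simp [Matrix.one_fin_two]

/-- The lower unipotent matrix with entry `y`. -/
def lower (y : F) : GL (Fin 2) F where
  val := !![1, 0; y, 1]
  inv := !![1, 0; -y, 1]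
  val_inv := by simp [Matrix.one_fin_two]
  inv_val := by simp [Matrix.one_fin_two]

/-- The diagonal matrix with entries `a`, `b`. -/
def diag (a b : Fˣ) : GL (Fin 2) F where
  val := !![(a : F), 0; 0, b]
  inv := !![((a⁻¹ : Fˣ) : F), 0; 0, (b⁻¹ : Fˣ)]
  val_inv := by simp [Matrix.one_fin_two]
  inv_val := by simp [Matrix.one_fin_two]

variable (F) in
/-- The permutation matrix exchanging the two basis vectors. -/
def flip : GL (Fin 2) F where
  val := !![0, 1; 1, 0]
  inv := !![0, 1; 1, 0]
  val_inv := by simp [Matrix.one_fin_two]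
  inv_val := by simp [Matrix.one_fin_two]

@[simp] theorem coe_upper (x : F) : (upper x : Matrix (Fin 2) (Fin 2) F) = !![1, x; 0, 1] := rfl
@[simp] theorem coe_lower (y : F) : (lower y : Matrix (Fin 2) (Fin 2) F) = !![1, 0; y, 1] := rfl
@[simp] theorem coe_diag (a b : Fˣ) :
    (diag a b : Matrix (Fin 2) (Fin 2) F) = !![(a : F), 0; 0, b] := rfl
@[simp] theorem coe_flip : (flip F : Matrix (Fin 2) (Fin 2) F) = !![0, 1; 1, 0] := rfl

theorem upper_neg (x : F) : upper (-x) = (upper x)⁻¹ := by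
  refine eq_inv_of_mul_eq_one_left (Units.ext ?_)
  simp [Matrix.one_fin_two]

theorem upper_zero : upper (0 : F) = 1 := Units.ext (by simp [Matrix.one_fin_two])

theorem lower_zero : lower (0 : F) = 1 := Units.ext (by simp [Matrix.one_fin_two])

theorem gl_smul_apply (γ : GL (Fin 2) F) (v : Fin 2 → F) (i : Fin 2) :
    (γ • v) i = γ i 0 * v 0 + γ i 1 * v 1 := by
  simp [Units.smul_def, Matrix.smul_eq_mulVec, Matrix.mulVec, dotProduct, Fin.sum_univ_two]

theorem scalar_mul_apply (a : Fˣ) (γ : GL (Fin 2) F) (i j : Fin 2) :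
    (GeneralLinearGroup.scalar (Fin 2) a * γ) i j = a * γ i j := by
  simp

theorem mul_upper_one_apply (γ : GL (Fin 2) F) (i : Fin 2) :
    (γ * upper 1 : GL (Fin 2) F) i 0 = γ i 0 ∧
      (γ * upper 1 : GL (Fin 2) F) i 1 = γ i 0 + γ i 1 := by
  simp [Matrix.mul_apply, Fin.sum_univ_two]

theorem det_entries (γ : GL (Fin 2) F) :
    (γ.det : F) = γ 0 0 * γ 1 1 - γ 0 1 * γ 1 0 := by
  simp [Matrix.det_fin_two]

theorem inv_entries (γ : GL (Fin 2) F) :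
    (γ⁻¹ : GL (Fin 2) F) 0 0 = (γ.det : F)⁻¹ * γ 1 1 ∧
    (γ⁻¹ : GL (Fin 2) F) 0 1 = -((γ.det : F)⁻¹ * γ 0 1) ∧
    (γ⁻¹ : GL (Fin 2) F) 1 0 = -((γ.det : F)⁻¹ * γ 1 0) ∧
    (γ⁻¹ : GL (Fin 2) F) 1 1 = (γ.det : F)⁻¹ * γ 0 0 := by
  simp [Matrix.coe_units_inv, Matrix.inv_def, Matrix.adjugate_fin_two, Ring.inverse_eq_inv']

/-- The Gauss decomposition of a matrix whose lower right entry does not vanish. -/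
theorem gauss_decomposition (γ : GL (Fin 2) F) (d : Fˣ) (hd : γ 1 1 = d) :
    γ = upper (γ 0 1 * (d : F)⁻¹) * (lower (γ 1 0 * d * (γ.det : F)⁻¹) * diag (γ.det * d⁻¹) d) := by
  have h := det_entries γ
  have h0 : (γ.det : F) ≠ 0 := γ.det.ne_zero
  rw [hd] at h
  refine Units.ext (Matrix.ext fun i j => ?_)
  fin_cases i <;> fin_cases j <;>
    simp [-GeneralLinearGroup.val_det_apply, hd, Matrix.mul_apply, Fin.sum_univ_two]
  · field_simp
    linear_combination -h
  · field_simp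

/-- Every basis of `F²` is the image of the standard basis under an element of `GL(2, F)`. -/
theorem exists_gl_basis (b : Module.Basis (Fin 2) F (Fin 2 → F)) :
    ∃ γ : GL (Fin 2) F, ∀ i, γ • (Pi.single i 1 : Fin 2 → F) = b i := by
  let e : (Fin 2 → F) ≃ₗ[F] (Fin 2 → F) := (Pi.basisFun F (Fin 2)).equiv b (Equiv.refl _)
  refine ⟨GeneralLinearGroup.toLin.symm (LinearMap.GeneralLinearGroup.ofLinearEquiv e),
    fun i => ?_⟩
  have h : ∀ (T : LinearMap.GeneralLinearGroup F (Fin 2 → F)) v,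
      GeneralLinearGroup.toLin.symm T • v = T.1 v := by
    intro T v
    obtain ⟨γ, rfl⟩ := GeneralLinearGroup.toLin.surjective T
    rw [MulEquiv.symm_apply_apply]
    rfl
  rw [h]
  show e _ = _
  rw [← Pi.basisFun_apply, Module.Basis.equiv_apply]
  rfl

end Matrices

/-! ### Stabilizers of the standard vertices -/

section Vertices

variable {F : Type*} [Field F] [ValuativeRel F] [TopologicalSpace F] [IsNonarchimedeanLocalField F]

local notation "vv" => ValuativeRel.valuation F
local notation "pr" => Matrix.ProjGenLinGroup.mk (n := Fin 2) (R := F)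

theorem val_unif_pos (n : ℤ) : 0 < vv (unif F : F) ^ n := zpow_pos (by simp [zero_lt_iff]) _

theorem gl_smul_stdSub_le {γ : GL (Fin 2) F} {n : ℤ} (h00 : vv (γ 0 0) ≤ 1)
    (h01 : vv (γ 0 1) * vv (unif F : F) ^ n ≤ 1) (h10 : vv (γ 1 0) ≤ vv (unif F : F) ^ n)
    (h11 : vv (γ 1 1) ≤ 1) : γ • stdSub F n ≤ stdSub F n := by
  intro x hx
  obtain ⟨v, hv, rfl⟩ := mem_gl_smul.1 hx
  rw [mem_stdSub] at hv ⊢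
  rw [gl_smul_apply, gl_smul_apply]
  refine ⟨Valuation.map_add_le _ ?_ ?_, Valuation.map_add_le _ ?_ ?_⟩
  · rw [map_mul]
    exact mul_le_one' h00 hv.1
  · rw [map_mul]
    exact (mul_le_mul_right hv.2 _).trans h01
  · rw [map_mul]
    exact (mul_le_of_le_one_right' hv.1).trans h10
  · rw [map_mul]
    exact (mul_le_of_le_one_left' h11).trans hv.2

theorem gl_smul_stdVertex {γ : GL (Fin 2) F} {n : ℤ} (h00 : vv (γ 0 0) ≤ 1)
    (h01 : vv (γ 0 1) * vv (unif F : F) ^ n ≤ 1) (h10 : vv (γ 1 0) ≤ vv (unif F : F) ^ n)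
    (h11 : vv (γ 1 1) ≤ 1) (hd : vv (γ.det : F) = 1) :
    pr γ • stdVertex F n = stdVertex F n := by
  refine congrArg Lattice.toVertex (Subtype.ext ?_)
  show γ • stdSub F n = stdSub F n
  refine le_antisymm (gl_smul_stdSub_le h00 h01 h10 h11) ?_
  have hi : γ⁻¹ • stdSub F n ≤ stdSub F n := by
    obtain ⟨e0, e1, e2, e3⟩ := inv_entries γ
    apply gl_smul_stdSub_le
    · simpa only [e0, map_mul, map_inv₀, hd, inv_one, one_mul] using h11
    · simpa only [e1, Valuation.map_neg, map_mul, map_inv₀, hd, inv_one, one_mul] using h01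
    · simpa only [e2, Valuation.map_neg, map_mul, map_inv₀, hd, inv_one, one_mul] using h10
    · simpa only [e3, map_mul, map_inv₀, hd, inv_one, one_mul] using h00
  simpa using gl_smul_mono γ hi

/-- The bounds satisfied by the entries of a matrix that multiplies a standard lattice by a
scalar `a`. -/
theorem val_entries_le {γ : GL (Fin 2) F} {n : ℤ} {a : Fˣ}
    (h : γ • stdSub F n = a • stdSub F n) :
    vv (γ 0 0) ≤ vv (a : F) ∧ vv (γ 0 1) * vv (unif F : F) ^ n ≤ vv (a : F) ∧
      vv (γ 1 0) ≤ vv (a : F) * vv (unif F : F) ^ n ∧ vv (γ 1 1) ≤ vv (a : F) := by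
  obtain ⟨j, hj⟩ := exists_val_eq_zpow a
  have hq := val_unif_pos (F := F) n
  have h0 : γ • (Pi.single 0 1 : Fin 2 → F) ∈ a • stdSub F n := by
    rw [← h]
    exact mem_gl_smul.2 ⟨_, mem_stdSub.2 (by simp), rfl⟩
  have h1 : γ • (Pi.single 1 ((unif F : F) ^ n) : Fin 2 → F) ∈ a • stdSub F n := by
    rw [← h]
    exact mem_gl_smul.2 ⟨_, mem_stdSub.2 (by simp), rfl⟩
  rw [mem_scalar_smul_stdSub hj, zpow_add₀ (by simp), ← hj] at h0 h1
  simp only [gl_smul_apply, Pi.single_eq_same, mul_one, ne_eq, one_ne_zero, not_false_eq_true,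
    Pi.single_eq_of_ne, mul_zero, add_zero, zero_ne_one, zero_add, map_mul, map_zpow₀] at h0 h1
  exact ⟨h0.1, h1.1, h0.2, le_of_mul_le_mul_right h1.2 hq⟩

theorem val_det_eq {γ : GL (Fin 2) F} {n : ℤ} {a : Fˣ}
    (h : γ • stdSub F n = a • stdSub F n) : vv (γ.det : F) = vv (a : F) ^ 2 := by
  have key : ∀ {γ : GL (Fin 2) F} {a : Fˣ}, γ • stdSub F n = a • stdSub F n →
      vv (γ.det : F) ≤ vv (a : F) ^ 2 := by
    intro γ a h
    obtain ⟨h0, h1, h2, h3⟩ := val_entries_le h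
    have hq := val_unif_pos (F := F) n
    rw [det_entries]
    refine (Valuation.map_sub _ _ _).trans (max_le ?_ ?_)
    · rw [map_mul, pow_two]
      exact mul_le_mul' h0 h3
    · rw [map_mul, pow_two]
      refine le_of_mul_le_mul_right ?_ hq
      calc vv (γ 0 1) * vv (γ 1 0) * vv (unif F : F) ^ n
          = vv (γ 0 1) * vv (unif F : F) ^ n * vv (γ 1 0) := mul_right_comm _ _ _
        _ ≤ vv (a : F) * (vv (a : F) * vv (unif F : F) ^ n) := mul_le_mul' h1 h2
        _ = _ := (mul_assoc _ _ _).symm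
  refine le_antisymm (key h) ?_
  have h' : γ⁻¹ • stdSub F n = a⁻¹ • stdSub F n := by
    rw [inv_smul_eq_iff, gl_smul_scalar, h, inv_smul_smul]
  have := key h'
  rw [map_inv, Units.val_inv_eq_inv_val, Units.val_inv_eq_inv_val, map_inv₀, map_inv₀,
    inv_pow] at this
  have h0 : (γ.det : F) ≠ 0 := γ.det.ne_zero
  exact (inv_le_inv₀ (by rw [zero_lt_iff, Valuation.ne_zero_iff]; exact h0)
    (by simp [zero_lt_iff])).1 this

theorem mk_smul_stdVertex_eq_iff {γ : GL (Fin 2) F} {n : ℤ} :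
    pr γ • stdVertex F n = stdVertex F n ↔ ∃ a : Fˣ, γ • stdSub F n = a • stdSub F n :=
  eq_comm.trans toVertex_eq_iff

/-- A matrix with unit determinant that fixes a standard vertex satisfies the bounds defining the
stabilizer of the standard lattice. -/
theorem val_entries_le_of_fix {γ : GL (Fin 2) F} {n : ℤ} (hd : vv (γ.det : F) = 1)
    (h : pr γ • stdVertex F n = stdVertex F n) :
    vv (γ 0 0) ≤ 1 ∧ vv (γ 0 1) * vv (unif F : F) ^ n ≤ 1 ∧
      vv (γ 1 0) ≤ vv (unif F : F) ^ n ∧ vv (γ 1 1) ≤ 1 := by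
  obtain ⟨a, ha⟩ := mk_smul_stdVertex_eq_iff.1 h
  have h1 : vv (a : F) = 1 := by
    have := val_det_eq ha
    rw [hd] at this
    exact (pow_eq_one_iff_of_nonneg zero_le two_ne_zero).1 this.symm
  simpa [h1] using val_entries_le ha

variable (F) in
/-- The maximal compact subgroup `GL(2, 𝒪)` of `GL(2, F)`, as a set. -/
def integralGL : Set (GL (Fin 2) F) := {γ | (∀ i j, vv (γ i j) ≤ 1) ∧ vv (γ.det : F) = 1}

/-- An element of `PGL(2, F)` that fixes a standard vertex lifts to a matrix with unit
determinant. -/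
theorem exists_lift_of_fix {g : PGL(2, F)} {n : ℤ} (h : g • stdVertex F n = stdVertex F n) :
    ∃ γ : GL (Fin 2) F, pr γ = g ∧ vv (γ.det : F) = 1 := by
  induction g using Matrix.ProjGenLinGroup.induction_on with
  | mk γ =>
    obtain ⟨a, ha⟩ := mk_smul_stdVertex_eq_iff.1 h
    have hd := val_det_eq ha
    refine ⟨GeneralLinearGroup.scalar (Fin 2) a⁻¹ * γ, by simp, ?_⟩
    rw [det_entries, scalar_mul_apply, scalar_mul_apply, scalar_mul_apply, scalar_mul_apply]
    have : ((a⁻¹ : Fˣ) : F) * γ 0 0 * (((a⁻¹ : Fˣ) : F) * γ 1 1) -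
        ((a⁻¹ : Fˣ) : F) * γ 0 1 * (((a⁻¹ : Fˣ) : F) * γ 1 0) = ((a : F)⁻¹) ^ 2 * γ.det := by
      rw [det_entries, Units.val_inv_eq_inv_val]
      ring
    rw [this, map_mul, hd, map_pow, map_inv₀, inv_pow]
    exact inv_mul_cancel₀ (by simp)

theorem stabilizer_stdVertex_zero :
    (MulAction.stabilizer PGL(2, F) (stdVertex F 0) : Set PGL(2, F)) = pr '' integralGL F := by
  ext g
  rw [SetLike.mem_coe, MulAction.mem_stabilizer_iff]
  constructor
  · intro h
    obtain ⟨γ, rfl, hd⟩ := exists_lift_of_fix h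
    obtain ⟨h0, h1, h2, h3⟩ := val_entries_le_of_fix hd h
    rw [zpow_zero] at h1 h2
    rw [mul_one] at h1
    refine ⟨γ, ⟨fun i j => ?_, hd⟩, rfl⟩
    fin_cases i <;> fin_cases j <;> assumption
  · rintro ⟨γ, ⟨h, hd⟩, rfl⟩
    exact gl_smul_stdVertex (h 0 0) (by simpa using h 0 1) (by simpa using h 1 0) (h 1 1) hd

theorem mk_upper_smul {x : F} {n : ℤ} (h : vv x * vv (unif F : F) ^ n ≤ 1) :
    pr (upper x) • stdVertex F n = stdVertex F n :=
  gl_smul_stdVertex (by simp) (by simpa using h) (by simp) (by simp)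
    (by simp)

theorem mk_lower_smul {y : F} {n : ℤ} (h : vv y ≤ vv (unif F : F) ^ n) :
    pr (lower y) • stdVertex F n = stdVertex F n :=
  gl_smul_stdVertex (by simp) (by simp) (by simpa using h) (by simp)
    (by simp)

/-- The action of diagonal matrices on the standard vertices. -/
theorem mk_diag_smul {a b : Fˣ} {j : ℤ} (h : vv (b : F) = vv (a : F) * vv (unif F : F) ^ j) (n : ℤ) :
    pr (diag a b) • stdVertex F n = stdVertex F (n + j) := by
  obtain ⟨i, hi⟩ := exists_val_eq_zpow a
  have ha : 0 < vv (a : F) := by simp [zero_lt_iff]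
  have hb : 0 < vv (b : F) := by simp [zero_lt_iff]
  refine (toVertex_eq_iff.2 ⟨a, ?_⟩).symm
  show diag a b • stdSub F n = a • stdSub F (n + j)
  ext x
  rw [mem_scalar_smul_stdSub hi, mem_gl_smul, add_left_comm, zpow_add₀ (by simp),
    zpow_add₀ (by simp), ← hi, mul_left_comm, mul_comm (vv (unif F : F) ^ n),
    ← mul_assoc, ← h]
  constructor
  · rintro ⟨v, hv, rfl⟩
    rw [mem_stdSub] at hv
    simp only [gl_smul_apply]
    simp only [coe_diag, of_apply, cons_val', cons_val_zero, cons_val_fin_one, zero_mul, add_zero,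
      cons_val_one, zero_add, map_mul]
    exact ⟨mul_le_of_le_one_right' hv.1, mul_le_mul_right hv.2 _⟩
  · rintro ⟨h1, h2⟩
    refine ⟨![(a : F)⁻¹ * x 0, (b : F)⁻¹ * x 1], mem_stdSub.2 ⟨?_, ?_⟩, ?_⟩
    · simpa using (inv_mul_le_one₀ ha).2 h1
    · simpa using (inv_mul_le_iff₀ hb).2 h2
    · ext i
      rw [gl_smul_apply]
      fin_cases i <;> simp

theorem mk_flip_smul (n : ℤ) : pr (flip F) • stdVertex F n = stdVertex F (-n) := by
  have hv : vv ((unif F ^ n : Fˣ) : F) = vv (unif F : F) ^ n := by simp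
  refine (toVertex_eq_iff.2 ⟨unif F ^ n, ?_⟩).symm
  show flip F • stdSub F n = unif F ^ n • stdSub F (-n)
  ext x
  rw [mem_scalar_smul_stdSub hv, mem_gl_smul, add_neg_cancel, zpow_zero]
  constructor
  · rintro ⟨v, hv, rfl⟩
    rw [mem_stdSub] at hv
    simpa [gl_smul_apply] using hv.symm
  · rintro ⟨h1, h2⟩
    refine ⟨![x 1, x 0], mem_stdSub.2 ⟨by simpa using h2, by simpa using h1⟩, ?_⟩
    ext i
    rw [gl_smul_apply]
    fin_cases i <;> simp

variable (F) in
/-- The element of `PGL(2, F)` moving the standard vertices by `j` steps. -/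
def shift (j : ℤ) : PGL(2, F) := pr (diag 1 (unif F ^ j))

theorem shift_smul (j n : ℤ) : shift F j • stdVertex F n = stdVertex F (n + j) :=
  mk_diag_smul (by simp) n

/-- `PGL(2, F)` acts transitively on vertices. -/
theorem exists_smul_stdVertex (x : Vertex F) : ∃ g : PGL(2, F), g • stdVertex F 0 = x := by
  induction x using Quotient.ind with
  | _ L =>
    have := L.2
    have hr : Module.finrank 𝒪[F] L.1 = 2 := by
      simpa using Submodule.IsLattice.finrank_of_pi (R := 𝒪[F]) F L.1
    let b := Module.finBasisOfFinrankEq 𝒪[F] L.1 hr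
    obtain ⟨γ, hγ⟩ := exists_gl_basis (b.extendOfIsLattice F)
    refine ⟨pr γ, congrArg Lattice.toVertex (Subtype.ext ?_)⟩
    show γ • stdSub F 0 = L.1
    refine (Submodule.map_span _ _).trans ?_
    rw [Set.image_pair]
    have h0 : γ • (Pi.single 0 1 : Fin 2 → F) = b 0 := by simpa using hγ 0
    have h1 : γ • (unif F ^ (0 : ℤ) • Pi.single 1 1 : Fin 2 → F) = b 1 := by simpa using hγ 1
    have hb := congrArg (Submodule.map L.1.subtype) b.span_eq
    rw [Submodule.map_span, Submodule.map_subtype_top] at hb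
    rw [← hb]
    refine congrArg _ ?_
    refine (congrArg₂ (fun u v => ({u, v} : Set (Fin 2 → F))) h0 h1).trans ?_
    ext z
    simp [eq_comm]

/-! ### Transitivity on paths -/

theorem val_le_zpow_add_one {z : F} {n : ℤ} (h : vv z < vv (unif F : F) ^ n) :
    vv z ≤ vv (unif F : F) ^ (n + 1) := by
  by_cases hz : z = 0
  · simp [hz]
  · obtain ⟨i, hi⟩ := exists_val_eq_zpow (Units.mk0 z hz)
    rw [Units.val_mk0] at hi
    rw [hi, lt_iff_not_ge, val_zpow_le_iff] at h
    rw [hi, val_zpow_le_iff]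
    omega

theorem smul_mem_of_val_le {N : Submodule 𝒪[F] (Fin 2 → F)} {c : F} (hc : vv c ≤ 1)
    {v : Fin 2 → F} (hv : v ∈ N) : c • v ∈ N :=
  N.smul_mem (⟨c, hc⟩ : 𝒪[F]) hv

/-- The lattices strictly between `𝒪 e₀ ⊕ 𝔭ⁿ e₁` and its multiple by `𝔭`. -/
theorem eq_of_lt_stdSub {n : ℤ} {N : Submodule 𝒪[F] (Fin 2 → F)}
    (h1 : unif F • stdSub F n < N) (h2 : N < stdSub F n) :
    N = unif F • stdSub F (n - 1) ∨
      ∃ y : F, vv y ≤ vv (unif F : F) ^ n ∧ N = lower y • stdSub F (n + 1) := by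
  have hmem : ∀ m (v : Fin 2 → F), v ∈ unif F • stdSub F m ↔
      vv (v 0) ≤ vv (unif F : F) ∧ vv (v 1) ≤ vv (unif F : F) ^ (1 + m) := fun m v => by
    rw [mem_scalar_smul_stdSub (j := 1) (by simp), zpow_one]
  have hpos := val_unif_pos (F := F) n
  by_cases hex : ∃ v ∈ N, vv (v 0) = 1
  · right
    obtain ⟨v, hvN, hv⟩ := hex
    have hv0 : v 0 ≠ 0 := by
      intro h
      simp [h] at hv
    obtain ⟨w, hwN, hw0⟩ : ∃ w ∈ N, w 0 = 1 :=
      ⟨(v 0)⁻¹ • v, smul_mem_of_val_le (by simp [hv]) hvN, by simp [hv0]⟩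
    have hy := (mem_stdSub.1 (h2.le hwN)).2
    refine ⟨w 1, hy, le_antisymm (fun x hx => ?_) (fun x hx => ?_)⟩
    · obtain ⟨hx0, hx1⟩ := mem_stdSub.1 (h2.le hx)
      have hzN : x - x 0 • w ∈ N := N.sub_mem hx (smul_mem_of_val_le hx0 hwN)
      have hz0 : (x - x 0 • w) 0 = 0 := by simp [hw0]
      have hz1 := (mem_stdSub.1 (h2.le hzN)).2
      have hz : vv ((x - x 0 • w) 1) ≤ vv (unif F : F) ^ (n + 1) := by
        rcases lt_or_eq_of_le hz1 with h | h
        · exact val_le_zpow_add_one h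
        · -- otherwise `N` contains both basis vectors of the standard lattice
          refine absurd (fun u hu => ?_) h2.not_ge
          obtain ⟨hu0, hu1⟩ := mem_stdSub.1 hu
          generalize x - x 0 • w = z at *
          have hne : z 1 ≠ 0 := by
            intro h'
            rw [h', map_zero] at h
            exact hpos.ne h
          have e : u = u 0 • w + ((u 1 - u 0 * w 1) * (z 1)⁻¹) • z := by
            ext i
            fin_cases i
            · simp [hw0, hz0]
            · simp [hne]
          rw [e]
          refine N.add_mem (smul_mem_of_val_le hu0 hwN) (smul_mem_of_val_le ?_ hzN)
          rw [map_mul, map_inv₀, h, mul_inv_le_iff₀ hpos, one_mul]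
          refine (Valuation.map_sub _ _ _).trans (max_le hu1 ?_)
          rw [map_mul]
          exact (mul_le_of_le_one_left' hu0).trans hy
      refine mem_gl_smul.2 ⟨![x 0, (x - x 0 • w) 1], mem_stdSub.2 ⟨hx0, hz⟩, ?_⟩
      ext i
      rw [gl_smul_apply]
      fin_cases i <;> simp [mul_comm]
    · obtain ⟨u, hu, rfl⟩ := mem_gl_smul.1 hx
      obtain ⟨hu0, hu1⟩ := mem_stdSub.1 hu
      have e : lower (w 1) • u = u 0 • w + ![0, u 1] := by
        ext i
        rw [gl_smul_apply]
        fin_cases i <;> simp [hw0, mul_comm]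
      rw [e]
      refine N.add_mem (smul_mem_of_val_le hu0 hwN) (h1.le ((hmem _ _).2 ?_))
      rw [add_comm 1]
      exact ⟨by simp, hu1⟩
  · left
    push Not at hex
    have hlt : ∀ v ∈ N, vv (v 0) ≤ vv (unif F : F) := fun v hv => by
      have := val_le_zpow_add_one (z := v 0) (n := 0)
        (by rw [zpow_zero]; exact lt_of_le_of_ne (mem_stdSub.1 (h2.le hv)).1 (hex v hv))
      simpa using this
    obtain ⟨v, hvN, hv⟩ := SetLike.exists_of_lt h1
    have hv1 : vv (v 1) = vv (unif F : F) ^ n := by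
      refine le_antisymm (mem_stdSub.1 (h2.le hvN)).2 (le_of_not_gt fun h => hv ?_)
      refine (hmem _ _).2 ⟨hlt v hvN, ?_⟩
      rw [add_comm]
      exact val_le_zpow_add_one h
    have hne : v 1 ≠ 0 := by
      intro h'
      rw [h', map_zero] at hv1
      exact hpos.ne hv1
    refine le_antisymm (fun x hx => ?_) (fun x hx => ?_)
    · rw [hmem, add_sub_cancel]
      exact ⟨hlt x hx, (mem_stdSub.1 (h2.le hx)).2⟩
    · rw [hmem, add_sub_cancel] at hx
      have hc : vv (x 1 * (v 1)⁻¹) ≤ 1 := by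
        rw [map_mul, map_inv₀, hv1, mul_inv_le_iff₀ hpos, one_mul]
        exact hx.2
      have e : x = (x 1 * (v 1)⁻¹) • v + ![x 0 - x 1 * (v 1)⁻¹ * v 0, 0] := by
        ext i
        fin_cases i <;> simp [hne]
      rw [e]
      refine N.add_mem (smul_mem_of_val_le hc hvN) (h1.le ((hmem _ _).2 ⟨?_, by simp⟩))
      refine (Valuation.map_sub _ _ _).trans (max_le hx.1 ?_)
      rw [map_mul]
      exact (mul_le_of_le_one_left' hc).trans (hlt v hvN)

/-- The neighbours of a standard vertex are the preceding standard vertex and the images of the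
following one under lower unipotent matrices, which fix all vertices up to the given one. -/
theorem eq_of_adj_stdVertex {n : ℤ} {x : Vertex F} (h : (tree F).Adj (stdVertex F n) x) :
    x = stdVertex F (n - 1) ∨
      ∃ y : F, vv y ≤ vv (unif F : F) ^ n ∧ x = pr (lower y) • stdVertex F (n + 1) := by
  obtain ⟨L, L', hL, rfl, h1, h2⟩ := h
  obtain ⟨a, ha⟩ := toVertex_eq_iff.1 hL
  have ha : stdSub F n = a • L.1 := ha
  have h1' := scalar_smul_strictMono (a := a) h1
  have h2' := scalar_smul_strictMono (a := a) h2
  rw [maximalIdeal_smul, smul_comm, ← ha] at h1'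
  rw [← ha] at h2'
  rcases eq_of_lt_stdSub h1' h2' with h | ⟨y, hy, h⟩
  · refine Or.inl (toVertex_eq_iff.2 ⟨(unif F)⁻¹ * a, ?_⟩)
    show stdSub F (n - 1) = ((unif F)⁻¹ * a) • L'.1
    rw [mul_smul, h, inv_smul_smul]
  · exact Or.inr ⟨y, hy, toVertex_eq_iff.2 ⟨a, h.symm⟩⟩

variable (F) in
/-- The `k`-path formed by the standard vertices with indices `n, …, n + k`. -/
def stdPath (k : ℕ) (n : ℤ) : KPath F k :=
  ⟨fun i => stdVertex F (n + i), fun i j h => by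
    have := stdVertex_injective h
    exact Fin.ext (by omega), fun i => stdVertex_adj_iff.2 (Or.inl (by
      simp [add_assoc]))⟩

theorem stdPath_val (k : ℕ) (n : ℤ) (i : Fin (k + 1)) :
    (stdPath F k n).1 i = stdVertex F (n + i) := rfl

theorem path_smul_val {k : ℕ} (g : PGL(2, F)) (s : KPath F k) (i : Fin (k + 1)) :
    (g • s).1 i = g • s.1 i := rfl

theorem stdPath_tail (k : ℕ) (n : ℤ) : (stdPath F (k + 1) n).tail = stdPath F k n := rfl

theorem stdPath_head (k : ℕ) (n : ℤ) : (stdPath F (k + 1) n).head = stdPath F k (n + 1) := by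
  refine Subtype.ext (funext fun i => congrArg (stdVertex F) ?_)
  simp only [Fin.val_succ, Nat.cast_succ]
  ring

theorem stdPath_injective (k : ℕ) : Function.Injective (stdPath F k) := by
  intro m n h
  have := stdVertex_injective (congrFun (congrArg Subtype.val h) 0)
  simpa using this

theorem shift_smul_stdPath (k : ℕ) (j n : ℤ) :
    shift F j • stdPath F k n = stdPath F k (n + j) := by
  refine Subtype.ext (funext fun i => ?_)
  rw [path_smul_val, stdPath_val, stdPath_val, shift_smul]
  congr 1
  ring

theorem smul_stdPath_eq {k : ℕ} {n : ℤ} {g : PGL(2, F)}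
    (h : ∀ m, n ≤ m → m ≤ n + k → g • stdVertex F m = stdVertex F m) :
    g • stdPath F k n = stdPath F k n :=
  Subtype.ext (funext fun i => h _ (by omega) (by omega))

theorem smul_stdVertex_of_smul_stdPath {k : ℕ} {n : ℤ} {g : PGL(2, F)}
    (h : g • stdPath F k n = stdPath F k n) {m : ℤ} (h1 : n ≤ m) (h2 : m ≤ n + k) :
    g • stdVertex F m = stdVertex F m := by
  obtain ⟨i, rfl⟩ := Int.le.dest h1
  exact congrFun (congrArg Subtype.val h) ⟨i, by omega⟩

/-- `PGL(2, F)` acts transitively on `k`-paths. -/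
theorem exists_smul_stdPath {k : ℕ} (s : KPath F k) : ∃ g : PGL(2, F), g • stdPath F k 0 = s := by
  induction k with
  | zero =>
    obtain ⟨g, hg⟩ := exists_smul_stdVertex (s.1 0)
    refine ⟨g, Subtype.ext (funext fun i => ?_)⟩
    rw [Fin.fin_one_eq_zero i, path_smul_val, stdPath_val, ← hg]
    simp
  | succ k ih =>
    obtain ⟨g, hg⟩ := ih s.tail
    have hlast : ∀ u : PGL(2, F), u • stdPath F k 0 = stdPath F k 0 →
        u • stdVertex F (k + 1) = g⁻¹ • s.1 (Fin.last _) → ∃ g : PGL(2, F),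
          g • stdPath F (k + 1) 0 = s := by
      intro u hu hu'
      refine ⟨g * u, Subtype.ext (funext fun i => ?_)⟩
      induction i using Fin.lastCases with
      | last =>
        rw [path_smul_val, stdPath_val, mul_smul, Fin.val_last, zero_add, Nat.cast_succ, hu',
          smul_inv_smul]
      | cast i =>
        have : (g * u) • stdPath F k 0 = s.tail := by rw [mul_smul, hu, hg]
        exact congrFun (congrArg Subtype.val this) i
    have hk : g • stdVertex F k = s.1 (Fin.last k).castSucc := by
      have := congrFun (congrArg Subtype.val hg) (Fin.last k)
      rw [path_smul_val, stdPath_val, zero_add] at this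
      exact this
    have hadj : (tree F).Adj (stdVertex F k) (g⁻¹ • s.1 (Fin.last _)) := by
      rw [← tree_adj_smul_iff g, smul_inv_smul, hk]
      exact s.2.2 (Fin.last k)
    rcases eq_of_adj_stdVertex hadj with h | ⟨y, hy, h⟩
    · cases k with
      | zero =>
        refine hlast (pr (flip F)) (smul_stdPath_eq fun m h1 h2 => ?_) ?_
        · obtain rfl : m = 0 := by simp at h2; omega
          simpa using mk_flip_smul (F := F) 0
        · rw [h, mk_flip_smul]
          simp
      | succ k =>
        -- the path would backtrack
        exfalso
        have h3 := congrFun (congrArg Subtype.val hg) (Fin.last k).castSucc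
        rw [path_smul_val, stdPath_val] at h3
        rw [inv_smul_eq_iff] at h
        have h4 : s.1 (Fin.last _) = s.1 (Fin.last k).castSucc.castSucc := by
          rw [h]
          refine Eq.trans ?_ h3
          congr 2
          simp
        have := congrArg Fin.val (s.2.1 h4)
        simp at this
    · refine hlast (pr (lower y)) (smul_stdPath_eq fun m h1 h2 => mk_lower_smul ?_) h.symm
      exact hy.trans (val_zpow_le_iff.2 (by simpa using h2))

/-! ### Transitivity on oriented apartments and the stabilizer of the standard one -/

theorem mem_stdApartment_verts {x : Vertex F} :
    x ∈ (stdApartment F).verts ↔ ∃ n, stdVertex F n = x := Iff.rfl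

theorem stdApartment_dir {m n : ℤ} :
    (stdApartment F).dir (stdVertex F m) (stdVertex F n) ↔ n = m + 1 := by
  constructor
  · rintro ⟨i, h1, h2⟩
    rw [stdVertex_injective h1, stdVertex_injective h2]
  · rintro rfl
    exact ⟨m, rfl, rfl⟩

theorem smul_stdApartment_eq {g : PGL(2, F)} {j : ℤ}
    (h : ∀ n, g • stdVertex F n = stdVertex F (n + j)) : g • stdApartment F = stdApartment F := by
  have h' : ∀ n, g⁻¹ • stdVertex F n = stdVertex F (n - j) := fun n => by
    rw [inv_smul_eq_iff, h, sub_add_cancel]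
  refine OrientedApartment.ext ?_ ?_
  · ext x
    rw [mem_smul_verts]
    constructor
    · rintro ⟨n, hn⟩
      exact ⟨n + j, by rw [← h, hn, smul_inv_smul]⟩
    · rintro ⟨n, rfl⟩
      exact ⟨n - j, (h' n).symm⟩
  · funext x y
    refine propext ?_
    rw [smul_dir]
    constructor
    · rintro ⟨n, h1, h2⟩
      refine ⟨n + j, ?_, ?_⟩
      · rw [← h, ← h1, smul_inv_smul]
      · rw [add_right_comm, ← h, ← h2, smul_inv_smul]
    · rintro ⟨n, rfl, rfl⟩
      rw [h', h']
      exact ⟨n - j, rfl, by congr 1; ring⟩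

theorem shift_smul_stdApartment (j : ℤ) : shift F j • stdApartment F = stdApartment F :=
  smul_stdApartment_eq (shift_smul j)

theorem mk_diag_smul_stdApartment (a b : Fˣ) : pr (diag a b) • stdApartment F = stdApartment F := by
  obtain ⟨j, hj⟩ := exists_val_eq_zpow (b * a⁻¹)
  refine smul_stdApartment_eq (mk_diag_smul (j := j) ?_)
  rw [← hj, ← map_mul, ← Units.val_mul, mul_comm b, mul_inv_cancel_left]

theorem mem_torus_iff {g : PGL(2, F)} : g ∈ torus F ↔ ∃ a b : Fˣ, g = pr (diag a b) := by
  constructor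
  · rintro ⟨u, rfl⟩
    let w : Fin 2 → Fˣ := MulEquiv.piUnits u
    refine ⟨w 0, w 1, congrArg pr (Units.ext (Matrix.ext fun i j => ?_))⟩
    fin_cases i <;> fin_cases j <;> simp [w]
  · rintro ⟨a, b, rfl⟩
    refine ⟨MulEquiv.piUnits.symm ![a, b], congrArg pr (Units.ext (Matrix.ext fun i j => ?_))⟩
    fin_cases i <;> fin_cases j <;> simp

theorem eq_zero_of_forall_val_le {x : F} (a : Fˣ)
    (h : ∀ n : ℤ, vv x ≤ vv (a : F) * vv (unif F : F) ^ n) : x = 0 := by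
  by_contra hx
  obtain ⟨i, hi⟩ := exists_val_eq_zpow (Units.mk0 x hx)
  obtain ⟨j, hj⟩ := exists_val_eq_zpow a
  have := h (i + 1 - j)
  rw [Units.val_mk0] at hi
  rw [hi, hj, ← zpow_add₀ (by simp), val_zpow_le_iff] at this
  omega

/-- The stabilizer of the standard oriented apartment is the diagonal torus. -/
theorem smul_stdApartment_eq_iff {g : PGL(2, F)} :
    g • stdApartment F = stdApartment F ↔ g ∈ torus F := by
  constructor
  · intro h
    have hv : ∀ n, ∃ m, stdVertex F m = g • stdVertex F n := fun n => by
      rw [← mem_stdApartment_verts, ← h, mem_smul_verts, inv_smul_smul]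
      exact ⟨n, rfl⟩
    choose φ hφ using hv
    have hstep : ∀ n, φ (n + 1) = φ n + 1 := fun n => by
      rw [← stdApartment_dir (F := F), hφ, hφ, ← h, smul_dir, inv_smul_smul, inv_smul_smul]
      exact ⟨n, rfl, rfl⟩
    have htr : ∀ n, φ n = n + φ 0 := fun n => by
      induction n using Int.induction_on with
      | zero => simp
      | succ i ih => rw [hstep, ih]; ring
      | pred i ih =>
        have := hstep (-i - 1)
        rw [sub_add_cancel, ih] at this
        omega
    have hfix : ∀ n, (shift F (-φ 0) * g) • stdVertex F n = stdVertex F n := fun n => by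
      rw [mul_smul, ← hφ, shift_smul, htr n, add_neg_cancel_right]
    obtain ⟨γ, hγ, hd⟩ := exists_lift_of_fix (hfix 0)
    have hb := fun n => val_entries_le_of_fix hd (hγ ▸ hfix n)
    have h01 : γ 0 1 = 0 := eq_zero_of_forall_val_le 1 fun n => by
      have := (hb (-n)).2.1
      rw [Units.val_one, map_one, one_mul]
      rwa [_root_.zpow_neg, mul_inv_le_iff₀ (val_unif_pos n), one_mul] at this
    have h10 : γ 1 0 = 0 := eq_zero_of_forall_val_le 1 fun n => by
      simpa using (hb n).2.2.1
    have hdet := det_entries γ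
    rw [h01, zero_mul, sub_zero] at hdet
    have hne : γ 0 0 * γ 1 1 ≠ 0 := hdet ▸ γ.det.ne_zero
    have hγd : γ = diag (Units.mk0 _ (left_ne_zero_of_mul hne))
        (Units.mk0 _ (right_ne_zero_of_mul hne)) :=
      Units.ext (Matrix.ext fun i j => by
        fin_cases i <;> fin_cases j <;> simp [h01, h10])
    have h1 : pr γ ∈ torus F := mem_torus_iff.2 ⟨_, _, congrArg _ hγd⟩
    have h2 : shift F (-φ 0) ∈ torus F := mem_torus_iff.2 ⟨_, _, rfl⟩
    rw [hγ] at h1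
    exact (Subgroup.mul_mem_cancel_left _ h2).1 h1
  · intro h
    obtain ⟨a, b, rfl⟩ := mem_torus_iff.1 h
    exact mk_diag_smul_stdApartment a b

theorem exists_smul_verts_eq {A : Set (Vertex F)} (h : IsApartment A) :
    ∃ g : PGL(2, F), A = g • (stdApartment F).verts := by
  obtain ⟨b, rfl⟩ := h
  obtain ⟨γ, hγ⟩ := exists_gl_basis b
  have hspan : ∀ α β : Fˣ, γ • diag α β • stdSub F 0 =
      Submodule.span 𝒪[F] {α • b 0, β • b 1} := by
    intro α β
    rw [smul_smul]
    refine (Submodule.map_span _ _).trans ?_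
    rw [Set.image_pair, ← hγ, ← hγ]
    have h0 : diag α β • (Pi.single 0 1 : Fin 2 → F) = α • Pi.single 0 1 := by
      ext i
      rw [gl_smul_apply]
      fin_cases i <;> simp [Units.smul_def]
    have h1 : diag α β • (unif F ^ (0 : ℤ) • Pi.single 1 1 : Fin 2 → F) = β • Pi.single 1 1 := by
      ext i
      rw [gl_smul_apply]
      fin_cases i <;> simp [Units.smul_def]
    rw [← smul_comm γ α, ← smul_comm γ β, ← h0, ← h1, smul_smul, smul_smul]
    rfl
  refine ⟨pr γ, ?_⟩
  ext x
  constructor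
  · rintro ⟨L, rfl, α, β, h⟩
    obtain ⟨j, hj⟩ := exists_val_eq_zpow (α⁻¹ * β)
    have hdiag := mk_diag_smul (a := α) (b := β) (j := j)
      (by rw [← hj, ← map_mul, ← Units.val_mul, mul_inv_cancel_left]) 0
    refine Set.mem_smul_set.2 ⟨_, ⟨0 + j, rfl⟩, ?_⟩
    rw [← hdiag]
    exact congrArg Lattice.toVertex (Subtype.ext ((hspan α β).trans h.symm))
  · intro hx
    obtain ⟨_, ⟨j, rfl⟩, rfl⟩ := Set.mem_smul_set.1 hx
    have h := shift_smul (F := F) j 0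
    rw [zero_add] at h
    exact ⟨γ • diag 1 (unif F ^ j) • stdLattice F 0, by rw [← h]; rfl, 1, unif F ^ j, hspan _ _⟩

/-- `PGL(2, F)` acts transitively on oriented apartments. -/
theorem exists_smul_stdApartment (A : OrientedApartment F) :
    ∃ g : PGL(2, F), g • stdApartment F = A := by
  -- it is enough to treat an apartment with the standard vertices, oriented by increasing indices
  have key : ∀ B : OrientedApartment F, B.verts = (stdApartment F).verts →
      B.dir (stdVertex F 0) (stdVertex F 1) → B = stdApartment F := by
    intro B hB h0
    have hmem : ∀ n, stdVertex F n ∈ B.verts := fun n => hB ▸ ⟨n, rfl⟩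
    have htot : ∀ n, B.dir (stdVertex F n) (stdVertex F (n + 1)) ∨
        B.dir (stdVertex F (n + 1)) (stdVertex F n) := fun n =>
      B.isOrientation.total (hmem _) (hmem _) (stdVertex_adj_iff.2 (Or.inl rfl))
    have hdir : ∀ n, B.dir (stdVertex F n) (stdVertex F (n + 1)) := fun n => by
      induction n using Int.induction_on with
      | zero => exact h0
      | succ i ih =>
        refine (htot _).resolve_right fun h => ?_
        have := stdVertex_injective (B.isOrientation.tail_unique h ih)
        omega
      | pred i ih =>
        refine (htot _).resolve_right fun h => ?_
        rw [sub_add_cancel] at h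
        have := stdVertex_injective (B.isOrientation.head_unique h ih)
        omega
    refine OrientedApartment.ext hB (funext fun x => funext fun y => propext ⟨fun h => ?_, ?_⟩)
    · obtain ⟨hx, hy, hadj⟩ := B.isOrientation.edge h
      rw [hB] at hx hy
      obtain ⟨m, rfl⟩ := hx
      obtain ⟨n, rfl⟩ := hy
      rcases stdVertex_adj_iff.1 hadj with rfl | rfl
      · exact ⟨m, rfl, rfl⟩
      · exact absurd h (B.isOrientation.asymm (hdir n))
    · rintro ⟨n, rfl, rfl⟩
      exact hdir n
  obtain ⟨g, hg⟩ := exists_smul_verts_eq A.isApartment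
  have hB : (g⁻¹ • A).verts = (stdApartment F).verts := by
    show g⁻¹ • A.verts = _
    rw [hg, inv_smul_smul]
  have hmem : ∀ n, stdVertex F n ∈ (g⁻¹ • A).verts := fun n => hB ▸ ⟨n, rfl⟩
  rcases (g⁻¹ • A).isOrientation.total (hmem 0) (hmem 1)
    (stdVertex_adj_iff.2 (Or.inl (by simp))) with h | h
  · exact ⟨g, by rw [← key _ hB h, smul_inv_smul]⟩
  · -- reverse the orientation by the reflection exchanging the vertices `0` and `1`
    let r : PGL(2, F) := shift F 1 * pr (flip F)
    have hr : ∀ n, r • stdVertex F n = stdVertex F (1 - n) := fun n => by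
      rw [mul_smul, mk_flip_smul, shift_smul, neg_add_eq_sub]
    have hr' : ∀ n, r⁻¹ • stdVertex F n = stdVertex F (1 - n) := fun n => by
      rw [inv_smul_eq_iff, hr, sub_sub_cancel]
    have := key (r • g⁻¹ • A) (by
      ext x
      rw [mem_smul_verts, hB]
      constructor
      · rintro ⟨n, hn⟩
        exact ⟨1 - n, by rw [← hr, hn, smul_inv_smul]⟩
      · rintro ⟨n, rfl⟩
        exact ⟨1 - n, (hr' n).symm⟩) (by
      rw [smul_dir, hr', hr']
      simpa using h)
    exact ⟨g * r⁻¹, by rw [← this, mul_smul, inv_smul_smul, smul_inv_smul]⟩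

/-! ### Topology of `PGL(2, F)` and of the space of oriented apartments -/

theorem continuous_pr : Continuous pr :=
  (continuous_quotient_mk' : Continuous (QuotientGroup.mk : GL (Fin 2) F → _))

theorem isOpenMap_pr : IsOpenMap pr :=
  (QuotientGroup.isOpenMap_coe : IsOpenMap
    (QuotientGroup.mk : GL (Fin 2) F → GL (Fin 2) F ⧸ Subgroup.center (GL (Fin 2) F)))

theorem isOpen_val_le_one : IsOpen {x : F | vv x ≤ 1} := Valuation.isOpen_integer (v := vv)

theorem isOpen_val_eq_one : IsOpen {x : F | vv x = 1} := by
  refine isOpen_iff_mem_nhds.2 fun x (hx : vv x = 1) => ?_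
  have := Valuation.locally_const (v := vv) (x := x) (by simp [hx])
  rwa [hx] at this

theorem continuous_entry (i j : Fin 2) : Continuous fun γ : GL (Fin 2) F => γ i j :=
  (Units.continuous_val (M := Matrix (Fin 2) (Fin 2) F)).matrix_elem i j

theorem isOpen_integralGL : IsOpen (integralGL F) := by
  have hd : Continuous fun γ : GL (Fin 2) F => (γ.det : F) :=
    (Units.continuous_val (M := Matrix (Fin 2) (Fin 2) F)).matrix_det
  have : integralGL F = (⋂ i, ⋂ j, {γ : GL (Fin 2) F | vv (γ i j) ≤ 1}) ∩
      {γ | vv (γ.det : F) = 1} := by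
    ext γ
    simp [integralGL]
  rw [this]
  exact (isOpen_iInter_of_finite fun i => isOpen_iInter_of_finite fun j =>
    isOpen_val_le_one.preimage (continuous_entry i j)).inter (isOpen_val_eq_one.preimage hd)

variable (F) in
theorem t2Space : T2Space F := by
  refine IsTopologicalAddGroup.t2Space_of_zero_sep fun x hx => ?_
  have h : {y : F | vv y = vv x} ∈ nhds (x - 0) := by
    rw [sub_zero]
    exact Valuation.locally_const (v := vv) (by simpa using hx)
  refine ⟨_, (continuous_const.sub continuous_id).continuousAt.preimage_mem_nhds h, fun h' => ?_⟩
  have h' : vv (x - x) = vv x := h'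
  rw [sub_self, map_zero] at h'
  exact hx ((Valuation.zero_iff _).1 h'.symm)

theorem isCompact_integralGL : IsCompact (integralGL F) := by
  have : CompactSpace (Matrix (Fin 2) (Fin 2) 𝒪[F]) :=
    inferInstanceAs (CompactSpace (Fin 2 → Fin 2 → 𝒪[F]))
  have hT : T1Space (Matrix (Fin 2) (Fin 2) 𝒪[F]) := by
    have := t2Space F
    infer_instance
  have hcomp : CompactSpace (GL (Fin 2) 𝒪[F]) :=
    inferInstanceAs (CompactSpace (Matrix (Fin 2) (Fin 2) 𝒪[F])ˣ)
  have hcont : Continuous (GeneralLinearGroup.map (n := Fin 2) (algebraMap 𝒪[F] F)) := by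
    refine Continuous.units_map _ ?_
    exact continuous_id.matrix_map continuous_subtype_val
  convert isCompact_range hcont
  ext γ
  constructor
  · rintro ⟨h, hd⟩
    let A : Matrix (Fin 2) (Fin 2) 𝒪[F] := fun i j => ⟨γ i j, h i j⟩
    have hA : IsUnit A.det := by
      refine (Valuation.integer.integers vv).isUnit_iff_valuation_eq_one.2 ?_
      rw [← hd, det_entries, det_fin_two]
      rfl
    refine ⟨GeneralLinearGroup.mk'' A hA, Units.ext (Matrix.ext fun i j => rfl)⟩
  · rintro ⟨δ, rfl⟩
    refine ⟨fun i j => (δ i j).2, ?_⟩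
    have := (Valuation.integer.integers vv).isUnit_iff_valuation_eq_one.1 δ.det.isUnit
    rw [← this]
    congr 1

theorem isCompact_stabilizer_stdVertex_zero :
    IsCompact (MulAction.stabilizer PGL(2, F) (stdVertex F 0) : Set PGL(2, F)) := by
  rw [stabilizer_stdVertex_zero]
  exact isCompact_integralGL.image continuous_pr

theorem isOpen_stabilizer_vertex (x : Vertex F) :
    IsOpen (MulAction.stabilizer PGL(2, F) x : Set PGL(2, F)) := by
  obtain ⟨g, rfl⟩ := exists_smul_stdVertex x
  have h0 : IsOpen (MulAction.stabilizer PGL(2, F) (stdVertex F 0) : Set PGL(2, F)) := by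
    rw [stabilizer_stdVertex_zero]
    exact isOpenMap_pr _ isOpen_integralGL
  have hc : Continuous fun h : PGL(2, F) => g⁻¹ * h * g := by fun_prop
  convert h0.preimage hc
  ext h
  simp [MulAction.mem_stabilizer_iff, mul_smul, inv_smul_eq_iff]

theorem isOpen_stabilizer_path {k : ℕ} (s : KPath F k) :
    IsOpen (MulAction.stabilizer PGL(2, F) s : Set PGL(2, F)) := by
  have : (MulAction.stabilizer PGL(2, F) s : Set PGL(2, F)) =
      ⋂ i, (MulAction.stabilizer PGL(2, F) (s.1 i) : Set PGL(2, F)) := by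
    ext g
    simp only [SetLike.mem_coe, MulAction.mem_stabilizer_iff, Set.mem_iInter]
    exact ⟨fun h i => congrFun (congrArg Subtype.val h) i, fun h => Subtype.ext (funext h)⟩
  rw [this]
  exact isOpen_iInter_of_finite fun i => isOpen_stabilizer_vertex _

theorem isLocallyConstant_smul_path {k : ℕ} (s : KPath F k) :
    IsLocallyConstant fun g : PGL(2, F) => g • s := by
  refine (IsLocallyConstant.iff_exists_open _).2 fun g =>
    ⟨(fun h => g⁻¹ * h) ⁻¹' (MulAction.stabilizer PGL(2, F) s : Set PGL(2, F)),
      (isOpen_stabilizer_path s).preimage (continuous_const_mul _), ?_, fun h hh => ?_⟩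
  · simp
  · rw [Set.mem_preimage, SetLike.mem_coe, MulAction.mem_stabilizer_iff, mul_smul,
      inv_smul_eq_iff] at hh
    exact hh

theorem finite_image_of_isCompact {X Y : Type*} [TopologicalSpace X] {f : X → Y}
    (hf : IsLocallyConstant f) {C : Set X} (hC : IsCompact C) : (f '' C).Finite := by
  let : TopologicalSpace Y := ⊥
  have : DiscreteTopology Y := ⟨rfl⟩
  exact (hC.image hf.continuous).finite_of_discrete

theorem isLocallyConstant_apartment_iff {Y : Type*} {f : OrientedApartment F → Y} :
    IsLocallyConstant f ↔ IsLocallyConstant fun g : PGL(2, F) => f (g • stdApartment F) :=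
  ⟨fun h => h.comp_continuous continuous_coinduced_rng, fun h s => isOpen_coinduced.2 (h s)⟩

theorem continuous_orbit : Continuous fun g : PGL(2, F) => g • stdApartment F :=
  continuous_coinduced_rng

theorem smul_stdApartment_eq_smul_iff {g h : PGL(2, F)} :
    g • stdApartment F = h • stdApartment F ↔ ∃ t ∈ torus F, g = h * t := by
  constructor
  · intro e
    exact ⟨h⁻¹ * g, smul_stdApartment_eq_iff.1 (by rw [mul_smul, e, inv_smul_smul]), by group⟩
  · rintro ⟨t, ht, rfl⟩
    rw [mul_smul, smul_stdApartment_eq_iff.2 ht]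

theorem isOpenMap_orbit : IsOpenMap fun g : PGL(2, F) => g • stdApartment F := by
  intro V hV
  refine isOpen_coinduced.2 ?_
  have : (fun g : PGL(2, F) => g • stdApartment F) ⁻¹'
      ((fun g : PGL(2, F) => g • stdApartment F) '' V) = V * (torus F : Set PGL(2, F)) := by
    ext g
    simp only [Set.mem_preimage, Set.mem_image, Set.mem_mul, SetLike.mem_coe]
    constructor
    · rintro ⟨v, hv, e⟩
      obtain ⟨t, ht, rfl⟩ := smul_stdApartment_eq_smul_iff.1 e.symm
      exact ⟨v, hv, t, ht, rfl⟩
    · rintro ⟨v, hv, t, ht, rfl⟩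
      exact ⟨v, hv, (smul_stdApartment_eq_smul_iff.2 ⟨t, ht, rfl⟩).symm⟩
  rw [this]
  exact hV.mul_right

theorem hasCompactSupport_of_subset {X : Type*} [TopologicalSpace X] {f : X → ℂ}
    (hf : IsLocallyConstant f) {C : Set X} (hC : IsCompact C) (h : Function.support f ⊆ C) :
    HasCompactSupport f := by
  have hcl : IsClosed (Function.support f) := (hf.isOpen_fiber 0).isClosed_compl
  rw [HasCompactSupport, tsupport, hcl.closure_eq]
  exact hC.of_isClosed_subset hcl h

/-! ### The Radon transform as a sum over the integers -/

theorem smul_mem_paths {k : ℕ} {g : PGL(2, F)} {A : OrientedApartment F} {s : KPath F k} :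
    g • s ∈ (g • A).paths k ↔ s ∈ A.paths k := by
  have h : ∀ i, g⁻¹ • (g • s).1 i = s.1 i := fun i => inv_smul_smul g _
  simp only [OrientedApartment.paths, Set.mem_ofPred_eq, mem_smul_verts, smul_dir, h]

theorem stdApartment_paths (k : ℕ) : (stdApartment F).paths k = Set.range (stdPath F k) := by
  ext s
  constructor
  · rintro ⟨h1, h2⟩
    obtain ⟨n, hn⟩ := h1 0
    refine ⟨n, Subtype.ext (funext fun i => ?_)⟩
    rw [stdPath_val]
    induction i using Fin.induction with
    | zero => simpa using hn
    | succ i ih =>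
      obtain ⟨m, h3, h4⟩ := h2 i
      rw [← ih] at h3
      have := stdVertex_injective h3
      rw [h4, ← this]
      congr 1
      simp [add_assoc]
  · rintro ⟨n, rfl⟩
    refine ⟨fun i => ⟨_, rfl⟩, fun i => stdApartment_dir.2 ?_⟩
    simp [add_assoc]

theorem smul_stdApartment_paths (k : ℕ) (g : PGL(2, F)) :
    (g • stdApartment F).paths k = Set.range fun n => g • stdPath F k n := by
  ext s
  rw [← smul_inv_smul g s, smul_mem_paths, stdApartment_paths]
  simp [eq_inv_smul_iff]

theorem smul_stdPath_injective (k : ℕ) (g : PGL(2, F)) :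
    Function.Injective fun n => g • stdPath F k n :=
  (MulAction.injective g).comp (stdPath_injective k)

theorem radon_smul_stdApartment {k : ℕ} (ω : Cc1 F k) (g : PGL(2, F)) :
    radon F k ω (g • stdApartment F) = ∑ᶠ n : ℤ, ω (g • stdPath F (k + 1) n) := by
  show ∑ᶠ a ∈ (g • stdApartment F).paths (k + 1), ω a = _
  rw [smul_stdApartment_paths]
  exact finsum_mem_range (smul_stdPath_injective _ g)

theorem finite_support_smul_stdPath {k : ℕ} (ω : KPath F k →₀ ℂ) (g : PGL(2, F)) :
    (Function.support fun n : ℤ => ω (g • stdPath F k n)).Finite :=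
  ω.hasFiniteSupport.preimage (smul_stdPath_injective k g).injOn

theorem radon_pathRep {k : ℕ} (g : PGL(2, F)) (ω : Cc1 F k) (A : OrientedApartment F) :
    radon F k (pathRep F (k + 1) g ω) A = radon F k ω (g⁻¹ • A) := by
  obtain ⟨h, rfl⟩ := exists_smul_stdApartment A
  rw [smul_smul, radon_smul_stdApartment, radon_smul_stdApartment]
  simp only [pathRep_apply, mul_smul]

theorem exists_mem_stabilizer_of_mem_paths {k : ℕ} {g : PGL(2, F)} {A : OrientedApartment F}
    (h : g • stdPath F k 0 ∈ A.paths k) :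
    ∃ u ∈ MulAction.stabilizer PGL(2, F) (stdPath F k 0), A = (g * u) • stdApartment F := by
  obtain ⟨γ, rfl⟩ := exists_smul_stdApartment A
  rw [smul_stdApartment_paths] at h
  obtain ⟨n, hn⟩ := h
  refine ⟨g⁻¹ * (γ * shift F n), ?_, ?_⟩
  · rw [MulAction.mem_stabilizer_iff, mul_smul, mul_smul, shift_smul_stdPath, zero_add,
      inv_smul_eq_iff]
    exact hn
  · rw [mul_inv_cancel_left, mul_smul, shift_smul_stdApartment]

/-- The Radon transform of a cochain with finite support is locally constant with compact
support. -/
theorem radon_mem_CcApt {k : ℕ} (ω : Cc1 F k) : radon F k ω ∈ CcApt F := by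
  induction ω using Finsupp.induction_linear with
  | zero => rw [map_zero]; exact zero_mem _
  | add ω η h1 h2 => rw [map_add]; exact add_mem h1 h2
  | single a c =>
    obtain ⟨g, rfl⟩ := exists_smul_stdPath a
    have hlc : IsLocallyConstant (radon F k (Finsupp.single (g • stdPath F (k + 1) 0) c)) := by
      refine isLocallyConstant_apartment_iff.2 ((IsLocallyConstant.iff_exists_open _).2 fun x =>
        ⟨(fun y => y * x⁻¹) ⁻¹' (MulAction.stabilizer PGL(2, F) (g • stdPath F (k + 1) 0) :
          Set PGL(2, F)), (isOpen_stabilizer_path _).preimage (continuous_mul_const _), by simp,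
          fun y hy => ?_⟩)
      obtain ⟨u, rfl⟩ : ∃ u, y = u * x := ⟨y * x⁻¹, by simp⟩
      have hu : u • g • stdPath F (k + 1) 0 = g • stdPath F (k + 1) 0 := by simpa using hy
      have := radon_pathRep u (Finsupp.single (g • stdPath F (k + 1) 0) c)
        ((u * x) • stdApartment F)
      rw [← mul_smul, inv_mul_cancel_left] at this
      rw [← this]
      have hs : pathRep F (k + 1) u (Finsupp.single (g • stdPath F (k + 1) 0) c) =
          Finsupp.single (g • stdPath F (k + 1) 0) c :=
        Finsupp.mapDomain_single.trans (by rw [hu])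
      rw [hs]
    refine ⟨hlc, hasCompactSupport_of_subset hlc
      ((isCompact_stabilizer_stdVertex_zero.image (continuous_const_mul g)).image
        continuous_orbit) fun A hA => ?_⟩
    obtain ⟨a, ha, hne⟩ := exists_ne_zero_of_finsum_mem_ne_zero
      (show ∑ᶠ a ∈ A.paths (k + 1), Finsupp.single (g • stdPath F (k + 1) 0) c a ≠ 0 from hA)
    have hag : g • stdPath F (k + 1) 0 = a := by
      by_contra h
      exact hne (Finsupp.single_eq_of_ne (Ne.symm h))
    obtain ⟨u, hu, rfl⟩ := exists_mem_stabilizer_of_mem_paths (hag ▸ ha)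
    exact ⟨g * u, ⟨u, smul_stdVertex_of_smul_stdPath hu le_rfl (by positivity), rfl⟩, rfl⟩

/-! ### Norms of the columns of a matrix -/

/-- The sup norm of the `j`-th column of a matrix. -/
def colNorm (γ : GL (Fin 2) F) (j : Fin 2) : ValuativeRel.ValueGroupWithZero F :=
  max (vv (γ 0 j)) (vv (γ 1 j))

theorem val_le_colNorm (γ : GL (Fin 2) F) (i j : Fin 2) : vv (γ i j) ≤ colNorm γ j := by
  fin_cases i
  · exact le_max_left _ _
  · exact le_max_right _ _

theorem colNorm_eq_val (γ : GL (Fin 2) F) (j : Fin 2) : ∃ i, colNorm γ j = vv (γ i j) := by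
  rcases max_choice (vv (γ 0 j)) (vv (γ 1 j)) with h | h
  · exact ⟨0, h⟩
  · exact ⟨1, h⟩

theorem colNorm_scalar_mul (a : Fˣ) (γ : GL (Fin 2) F) (j : Fin 2) :
    colNorm (GeneralLinearGroup.scalar (Fin 2) a * γ) j = vv (a : F) * colNorm γ j := by
  simp only [colNorm, scalar_mul_apply, map_mul]
  exact (Monotone.map_max (f := fun x => vv (a : F) * x) fun _ _ h => mul_le_mul_right h _).symm

theorem colNorm_mul_diag (γ : GL (Fin 2) F) (a b : Fˣ) :
    colNorm (γ * diag a b) 0 = colNorm γ 0 * vv (a : F) ∧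
      colNorm (γ * diag a b) 1 = colNorm γ 1 * vv (b : F) := by
  have key : ∀ (j : Fin 2) (c : Fˣ), max (vv (γ 0 j * c)) (vv (γ 1 j * c)) =
      max (vv (γ 0 j)) (vv (γ 1 j)) * vv (c : F) := fun j c => by
    rw [map_mul, map_mul]
    exact (Monotone.map_max (f := fun x => x * vv (c : F)) fun _ _ h => mul_le_mul_left h _).symm
  simp only [colNorm, ← key]
  simp [Matrix.mul_apply, Fin.sum_univ_two]

theorem det_le_colNorm (γ : GL (Fin 2) F) : vv (γ.det : F) ≤ colNorm γ 0 * colNorm γ 1 := by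
  rw [det_entries]
  refine (Valuation.map_sub _ _ _).trans (max_le ?_ ?_)
  · rw [map_mul]
    exact mul_le_mul' (val_le_colNorm _ _ _) (val_le_colNorm _ _ _)
  · rw [map_mul, mul_comm]
    exact mul_le_mul' (val_le_colNorm _ _ _) (val_le_colNorm _ _ _)

theorem colNorm_pos (γ : GL (Fin 2) F) (j : Fin 2) : 0 < colNorm γ j := by
  rw [zero_lt_iff]
  intro h
  have h1 := det_le_colNorm γ
  have h2 : colNorm γ 0 * colNorm γ 1 = 0 := by
    fin_cases j
    · rw [show colNorm γ 0 = 0 from h, zero_mul]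
    · rw [show colNorm γ 1 = 0 from h, mul_zero]
  rw [h2, le_zero_iff, Valuation.zero_iff] at h1
  exact γ.det.ne_zero h1

theorem colNorm_le_of_mul_upper {γ : GL (Fin 2) F} (h : colNorm γ 1 < colNorm γ 0) :
    colNorm (γ * upper 1) 0 ≤ colNorm (γ * upper 1) 1 := by
  obtain ⟨i, hi⟩ := colNorm_eq_val γ 0
  have h1 : vv (γ i 1) < vv (γ i 0) := (val_le_colNorm γ i 1).trans_lt (hi ▸ h)
  have h2 : vv ((γ * upper 1 : GL (Fin 2) F) i 1) = vv (γ i 0) := by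
    rw [(mul_upper_one_apply γ i).2]
    exact Valuation.map_add_eq_of_lt_left _ h1
  have h3 : colNorm (γ * upper 1) 0 = colNorm γ 0 := by
    simp only [colNorm, (mul_upper_one_apply γ _).1]
  rw [h3, hi, ← h2]
  exact val_le_colNorm _ _ _

theorem exists_val_le_zpow (x : F) : ∃ n : ℤ, vv x ≤ vv (unif F : F) ^ n := by
  by_cases hx : x = 0
  · exact ⟨0, by simp [hx]⟩
  · obtain ⟨n, hn⟩ := exists_val_eq_zpow (Units.mk0 x hx)
    exact ⟨n, hn.le⟩

theorem exists_forall_val_le_zpow (γ : GL (Fin 2) F) :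
    ∃ n : ℤ, ∀ i j, vv (γ i j) ≤ vv (unif F : F) ^ n := by
  choose n hn using fun i j => exists_val_le_zpow (γ i j)
  obtain ⟨m, hm⟩ := (Set.finite_range fun p : Fin 2 × Fin 2 => n p.1 p.2).bddBelow
  exact ⟨m, fun i j => (hn i j).trans (val_zpow_le_iff.2 (hm ⟨(i, j), rfl⟩))⟩

/-- If the first column of `γ` is at most as long as the second one, the path at position `-m` in the
apartment of `γ` moves away from the class of `𝒪²` as `m` grows. So it can be a given path only if
`m` is below a bound, which does not depend on `γ`. -/
theorem exists_bound_position {k : ℕ} (h : PGL(2, F)) : ∃ M : ℕ, ∀ (γ : GL (Fin 2) F) (m : ℤ),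
    colNorm γ 0 ≤ colNorm γ 1 → pr γ • stdPath F k (-m) = h • stdPath F k 0 → m ≤ M := by
  induction h using Matrix.ProjGenLinGroup.induction_on with
  | mk η =>
    obtain ⟨i, hi⟩ := exists_forall_val_le_zpow η
    obtain ⟨j, hj⟩ := exists_val_eq_zpow η.det
    refine ⟨(j - 2 * i).toNat, fun γ m hγ e => ?_⟩
    have hu : ((pr η)⁻¹ * (pr γ * shift F (-m))) • stdVertex F 0 = stdVertex F 0 := by
      refine smul_stdVertex_of_smul_stdPath (k := k) (n := 0) ?_ le_rfl (by positivity)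
      rw [mul_smul, mul_smul, shift_smul_stdPath, zero_add, e, inv_smul_smul]
    obtain ⟨υ, hυ, hd⟩ := exists_lift_of_fix hu
    obtain ⟨h00, h01, h10, h11⟩ := val_entries_le_of_fix hd (hυ ▸ hu)
    rw [zpow_zero] at h01 h10
    rw [mul_one] at h01
    -- the entries of `η * υ` are bounded, and `γ` is `η * υ * diag 1 (ϖ ^ m)` up to a scalar
    have hent : ∀ r s, vv ((η * υ) r s) ≤ vv (unif F : F) ^ i := by
      intro r s
      have hυ' : ∀ t, vv (υ t s) ≤ 1 := fun t => by
        fin_cases t <;> fin_cases s <;> assumption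
      have : (η * υ) r s = η r 0 * υ 0 s + η r 1 * υ 1 s := by
        simp [Matrix.mul_apply, Fin.sum_univ_two]
      rw [this]
      refine Valuation.map_add_le _ ?_ ?_ <;> rw [map_mul]
      · exact (mul_le_of_le_one_right' (hυ' 0)).trans (hi _ _)
      · exact (mul_le_of_le_one_right' (hυ' 1)).trans (hi _ _)
    have hcol : ∀ s, colNorm (η * υ) s ≤ vv (unif F : F) ^ i := fun s =>
      max_le (hent 0 s) (hent 1 s)
    have hmk : pr (η * υ * diag 1 (unif F ^ m)) = pr γ := by
      rw [map_mul, map_mul, hυ, mul_inv_cancel_left, mul_assoc]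
      show pr γ * (pr (diag 1 (unif F ^ (-m))) * pr (diag 1 (unif F ^ m))) = pr γ
      rw [← map_mul]
      have : diag 1 (unif F ^ (-m)) * diag 1 (unif F ^ m) = 1 :=
        Units.ext (by simp [Matrix.one_fin_two,
          inv_mul_cancel₀ (zpow_ne_zero m (unif F).ne_zero)])
      rw [this, map_one, mul_one]
    obtain ⟨a, ha⟩ := ProjGenLinGroup.mk_eq_mk_iff.1 hmk
    have hγ' : γ = GeneralLinearGroup.scalar (Fin 2) a * (η * υ * diag 1 (unif F ^ m)) := by
      rw [← ha, GeneralLinearGroup.scalar_commute]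
    rw [hγ', colNorm_scalar_mul, colNorm_scalar_mul, (colNorm_mul_diag _ _ _).1,
      (colNorm_mul_diag _ _ _).2, Units.val_one, map_one, mul_one] at hγ
    have h1 := le_of_mul_le_mul_left hγ (by simp [zero_lt_iff])
    have h2 := det_le_colNorm (η * υ)
    have h3 : vv ((η * υ).det : F) = vv (unif F : F) ^ j := by
      rw [map_mul, Units.val_mul, map_mul, hd, mul_one, hj]
    have hq : vv ((unif F ^ m : Fˣ) : F) = vv (unif F : F) ^ m := by simp
    rw [hq] at h1
    have h4 : vv (unif F : F) ^ j ≤ vv (unif F : F) ^ (i + m + i) := by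
      rw [← h3, zpow_add₀ (by simp), zpow_add₀ (by simp)]
      refine h2.trans (mul_le_mul' (h1.trans (mul_le_mul_left (hcol 1) _)) (hcol 1))
    rw [val_zpow_le_iff] at h4
    omega

/-! ### Exactness -/

theorem finsum_int_eq_add {f : ℤ → ℂ} (hf : (Function.support f).Finite) :
    ∑ᶠ n, f n = ∑ᶠ n ∈ Set.Iio (0 : ℤ), f n + ∑ᶠ n ∈ Set.Ici (0 : ℤ), f n := by
  rw [← finsum_mem_univ, ← Set.Iio_union_Ici (a := (0 : ℤ))]
  refine finsum_mem_union' ?_ (hf.inter_of_right _) (hf.inter_of_right _)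
  exact Set.disjoint_left.2 fun n h1 h2 => (Set.mem_Iio.1 h1).not_ge h2

/-- The sum of `ω` over the edges of the apartment of `g` at negative positions. -/
def backSum {k : ℕ} (ω : Cc1 F k) (g : PGL(2, F)) : ℂ :=
  ∑ᶠ n ∈ Set.Iio (0 : ℤ), ω (g • stdPath F (k + 1) n)

theorem backSum_mul_of_fix_le {k : ℕ} (ω : Cc1 F k) (g : PGL(2, F)) {y : PGL(2, F)}
    (hy : ∀ n ≤ (k : ℤ), y • stdVertex F n = stdVertex F n) :
    backSum ω (g * y) = backSum ω g := by
  refine finsum_mem_congr rfl fun n hn => ?_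
  have hn : n < 0 := hn
  rw [mul_smul, smul_stdPath_eq fun m _ h => hy m (by push_cast at h; omega)]

/-- As the Radon transform of `ω` vanishes, the sum over the negative positions is the opposite of
the sum over the other ones, which does not see elements fixing the vertices `n ≥ 0`. -/
theorem backSum_mul_of_fix_ge {k : ℕ} {ω : Cc1 F k} (hω : radon F k ω = 0) (g : PGL(2, F))
    {x : PGL(2, F)} (hx : ∀ n, 0 ≤ n → x • stdVertex F n = stdVertex F n) :
    backSum ω (g * x) = backSum ω g := by
  have key : ∀ g : PGL(2, F),
      backSum ω g = -∑ᶠ n ∈ Set.Ici (0 : ℤ), ω (g • stdPath F (k + 1) n) := fun g => by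
    refine eq_neg_of_add_eq_zero_left ?_
    rw [backSum, ← finsum_int_eq_add (finite_support_smul_stdPath ω g), ← radon_smul_stdApartment,
      hω]
    rfl
  rw [key, key]
  congr 1
  refine finsum_mem_congr rfl fun n hn => ?_
  rw [mul_smul, smul_stdPath_eq fun m h _ => hx m (le_trans hn h)]

theorem backSum_mul_of_unit_entry {k : ℕ} {ω : Cc1 F k} (hω : radon F k ω = 0) (g : PGL(2, F))
    {γ : GL (Fin 2) F} (hd : vv (γ.det : F) = 1) (h01 : vv (γ 0 1) ≤ 1)
    (h10 : vv (γ 1 0) ≤ vv (unif F : F) ^ (k : ℤ)) (h11 : vv (γ 1 1) = 1) :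
    backSum ω (g * pr γ) = backSum ω g := by
  have hne : γ 1 1 ≠ 0 := by
    intro h
    simp [h] at h11
  have hx : ∀ n, 0 ≤ n →
      pr (upper (γ 0 1 * (γ 1 1)⁻¹)) • stdVertex F n = stdVertex F n := fun n hn => by
    refine mk_upper_smul ?_
    rw [map_mul, map_inv₀, h11, inv_one, mul_one]
    refine mul_le_one' h01 ?_
    rw [← zpow_zero (vv (unif F : F)), val_zpow_le_iff]
    exact hn
  have hy : ∀ n ≤ (k : ℤ),
      (pr (lower (γ 1 0 * γ 1 1 * (γ.det : F)⁻¹)) *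
        pr (diag (γ.det * (Units.mk0 _ hne)⁻¹) (Units.mk0 _ hne))) • stdVertex F n =
          stdVertex F n := fun n hn => by
    rw [mul_smul, mk_diag_smul (j := 0), add_zero]
    · refine mk_lower_smul ?_
      rw [map_mul, map_mul, map_inv₀, h11, hd, inv_one, mul_one, mul_one]
      exact h10.trans (val_zpow_le_iff.2 hn)
    · rw [Units.val_mul, map_mul, hd, Units.val_inv_eq_inv_val, map_inv₀, Units.val_mk0, h11]
      simp
  conv_lhs => rw [gauss_decomposition γ (Units.mk0 _ hne) rfl, map_mul, map_mul, ← mul_assoc]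
  exact (backSum_mul_of_fix_le ω _ hy).trans (backSum_mul_of_fix_ge hω _ hx)

/-- If the Radon transform of `ω` vanishes, the sum of `ω` over the edges of an apartment that
precede a given `k`-path depends only on this path. -/
theorem backSum_mul_of_mem_stabilizer {k : ℕ} {ω : Cc1 F k} (hω : radon F k ω = 0)
    (g : PGL(2, F)) {u : PGL(2, F)} (hu : u • stdPath F k 0 = stdPath F k 0) :
    backSum ω (g * u) = backSum ω g := by
  have hu0 := smul_stdVertex_of_smul_stdPath hu le_rfl (by positivity)
  have huk := smul_stdVertex_of_smul_stdPath hu (m := k) (by positivity) (by simp)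
  obtain ⟨γ, rfl, hd⟩ := exists_lift_of_fix hu0
  obtain ⟨h00, h01, -, h11⟩ := val_entries_le_of_fix hd hu0
  obtain ⟨-, -, h10, -⟩ := val_entries_le_of_fix hd huk
  rw [zpow_zero, mul_one] at h01
  rcases h11.lt_or_eq with hlt | heq
  · -- then `γ 1 0` is a unit, and so is the lower right entry of `γ * upper 1`
    have hx : ∀ n, 0 ≤ n → pr (upper 1) • stdVertex F n = stdVertex F n := fun n hn => by
      refine mk_upper_smul ?_
      rw [map_one, one_mul, ← zpow_zero (vv (unif F : F)), val_zpow_le_iff]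
      exact hn
    have hk : vv (unif F : F) ^ (k : ℤ) ≤ 1 := by
      rw [← zpow_zero (vv (unif F : F)), val_zpow_le_iff]
      positivity
    have hc : vv (γ 1 0) = 1 := by
      refine le_antisymm (h10.trans hk) (le_of_not_gt fun hc => ?_)
      refine absurd hd (ne_of_lt ?_)
      rw [det_entries]
      refine (Valuation.map_sub _ _ _).trans_lt (max_lt ?_ ?_) <;> rw [map_mul]
      · exact (mul_le_of_le_one_left' h00).trans_lt hlt
      · exact (mul_le_of_le_one_left' h01).trans_lt hc
    have e := mul_upper_one_apply γ
    have h := backSum_mul_of_unit_entry hω g (γ := γ * upper 1)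
      (by
        rw [map_mul, Units.val_mul, map_mul, hd, one_mul]
        simp)
      (by rw [(e 0).2]; exact Valuation.map_add_le _ h00 h01)
      (by rw [(e 1).1]; exact h10)
      (by rw [(e 1).2, Valuation.map_add_eq_of_lt_left _ (hc.symm ▸ hlt), hc])
    rw [← h, map_mul, ← mul_assoc]
    exact (backSum_mul_of_fix_ge hω _ hx).symm
  · exact backSum_mul_of_unit_entry hω g hd h01 h10 heq

/-- The primitive of a cochain `ω` with vanishing Radon transform: its value at a `k`-path is the
sum of `ω` over the edges that precede the path in an oriented apartment containing it. -/
def primitive {k : ℕ} (ω : Cc1 F k) (s : KPath F k) : ℂ :=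
  backSum ω (exists_smul_stdPath s).choose

theorem primitive_smul_stdPath {k : ℕ} {ω : Cc1 F k} (hω : radon F k ω = 0) (g : PGL(2, F)) :
    primitive ω (g • stdPath F k 0) = backSum ω g := by
  have h := (exists_smul_stdPath (g • stdPath F k 0)).choose_spec
  rw [primitive, ← backSum_mul_of_mem_stabilizer hω g
    (u := g⁻¹ * (exists_smul_stdPath (g • stdPath F k 0)).choose)
    (by rw [mul_smul, h, inv_smul_smul]), mul_inv_cancel_left]

theorem primitive_head_sub_tail {k : ℕ} {ω : Cc1 F k} (hω : radon F k ω = 0)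
    (a : KPath F (k + 1)) : primitive ω a.head - primitive ω a.tail = ω a := by
  obtain ⟨g, rfl⟩ := exists_smul_stdPath a
  rw [head_smul, tail_smul, stdPath_head, stdPath_tail, ← shift_smul_stdPath, ← mul_smul,
    primitive_smul_stdPath hω, primitive_smul_stdPath hω, sub_eq_iff_eq_add]
  have h1 : backSum ω (g * shift F 1) =
      ∑ᶠ n ∈ insert 0 (Set.Iio (0 : ℤ)), ω (g • stdPath F (k + 1) n) := by
    refine finsum_mem_eq_of_bijOn (fun n => n + 1) ⟨fun n hn => ?_, ?_, fun n hn => ?_⟩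
      fun n _ => ?_
    · have hn : n < 0 := hn
      simp only [Set.mem_insert_iff, Set.mem_Iio]
      omega
    · exact (add_left_injective 1).injOn
    · simp only [Set.mem_insert_iff, Set.mem_Iio] at hn
      exact ⟨n - 1, by simp only [Set.mem_Iio]; omega, by simp⟩
    · rw [mul_smul, shift_smul_stdPath]
  rw [h1, finsum_mem_insert' _ (by simp)
    ((finite_support_smul_stdPath ω g).inter_of_right _), backSum]

theorem finite_support_primitive {k : ℕ} {ω : Cc1 F k} (hω : radon F k ω = 0) :
    (Function.support (primitive ω)).Finite := by
  choose h hh using fun a : KPath F (k + 1) => exists_smul_stdPath a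
  choose M hM using fun a => exists_bound_position (k := k + 1) (h a)
  refine Set.Finite.subset (s := ⋃ a ∈ ω.support, ⋃ m ∈ Finset.range (M a + 1),
    (fun g : PGL(2, F) => g • stdPath F k m) '' ((fun u => h a * u) ''
      (MulAction.stabilizer PGL(2, F) (stdVertex F 0) : Set PGL(2, F)))) ?_ fun s hs => ?_
  · refine ω.support.finite_toSet.biUnion fun a _ => (Finset.finite_toSet _).biUnion fun m _ => ?_
    exact finite_image_of_isCompact (isLocallyConstant_smul_path _)
      (isCompact_stabilizer_stdVertex_zero.image (continuous_const_mul _))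
  -- choose an apartment through `s` that moves away from the base point in backward direction
  obtain ⟨γ, hγ, hcol⟩ : ∃ γ : GL (Fin 2) F,
      pr γ • stdPath F k 0 = s ∧ colNorm γ 0 ≤ colNorm γ 1 := by
    obtain ⟨g, rfl⟩ := exists_smul_stdPath s
    induction g using Matrix.ProjGenLinGroup.induction_on with
    | mk γ =>
      rcases le_or_gt (colNorm γ 0) (colNorm γ 1) with hle | hlt
      · exact ⟨γ, rfl, hle⟩
      · refine ⟨γ * upper 1, ?_, colNorm_le_of_mul_upper hlt⟩
        rw [map_mul, mul_smul, smul_stdPath_eq fun m hm _ => mk_upper_smul ?_]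
        rw [map_one, one_mul, ← zpow_zero (vv (unif F : F)), val_zpow_le_iff]
        exact hm
  have hs : primitive ω s ≠ 0 := hs
  rw [← hγ, primitive_smul_stdPath hω] at hs
  obtain ⟨n, hn, hne⟩ := exists_ne_zero_of_finsum_mem_ne_zero hs
  have hn : n < 0 := hn
  obtain ⟨m, rfl⟩ : ∃ m : ℕ, n = -m := ⟨(-n).toNat, by omega⟩
  have hm := hM (pr γ • stdPath F (k + 1) (-m)) γ m hcol (hh _).symm
  refine Set.mem_biUnion (x := pr γ • stdPath F (k + 1) (-m)) (by simpa using hne)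
    (Set.mem_biUnion (x := m) (by
      simp only [Finset.coe_range, Set.mem_Iio]
      omega) ?_)
  refine ⟨pr γ * shift F (-m), ⟨(h (pr γ • stdPath F (k + 1) (-m)))⁻¹ * (pr γ * shift F (-m)),
    ?_, by simp⟩, ?_⟩
  · refine smul_stdVertex_of_smul_stdPath (k := k + 1) (n := 0) ?_ le_rfl (by positivity)
    rw [mul_smul, mul_smul, shift_smul_stdPath, zero_add, inv_smul_eq_iff, hh]
  · simp only [mul_smul, shift_smul_stdPath]
    rw [add_neg_cancel, hγ]

/-- The sum of a coboundary over an oriented apartment telescopes. -/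
theorem radon_coboundary {k : ℕ} (f : Cc0 F k) : radon F k (coboundary F k f) = 0 := by
  funext A
  obtain ⟨g, rfl⟩ := exists_smul_stdApartment A
  rw [radon_smul_stdApartment]
  simp only [coboundary_apply, head_smul, tail_smul, stdPath_head, stdPath_tail]
  have hfin := finite_support_smul_stdPath f g
  have h1 : ∑ᶠ n : ℤ, f (g • stdPath F k (n + 1)) = ∑ᶠ n : ℤ, f (g • stdPath F k n) :=
    finsum_comp_equiv (Equiv.addRight (1 : ℤ)) (f := fun n => f (g • stdPath F k n))
  rw [finsum_sub_distrib (hfin.preimage (add_left_injective 1).injOn) hfin, h1, sub_self]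
  rfl

theorem radon_eq_zero_iff {k : ℕ} {ω : Cc1 F k} :
    radon F k ω = 0 ↔ ω ∈ Set.range (coboundary F k) := by
  constructor
  · intro hω
    refine ⟨Finsupp.ofSupportFinite _ (finite_support_primitive hω), ?_⟩
    ext a
    exact primitive_head_sub_tail hω a
  · rintro ⟨f, rfl⟩
    exact radon_coboundary f

/-! ### The compactly induced representation -/

/-- A compact set of oriented apartments is covered by finitely many translates of a given
neighbourhood of the standard apartment, by elements of a given set of representatives. -/
theorem exists_finite_cover {P : Set PGL(2, F)}
    (hP : ∀ A : OrientedApartment F, ∃ g ∈ P, g • stdApartment F = A) {H : Set PGL(2, F)}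
    (hH : IsOpen H) (h1 : 1 ∈ H) {S : Set (OrientedApartment F)} (hS : IsCompact S) :
    ∃ t : Finset PGL(2, F), (t : Set PGL(2, F)) ⊆ P ∧
      ∀ A ∈ S, ∃ g ∈ t, ∃ u ∈ H, (g * u) • stdApartment F = A := by
  have hopen : ∀ g : PGL(2, F), IsOpen ((fun u => (g * u) • stdApartment F) '' H) := fun g => by
    have := isOpenMap_orbit _ ((isOpenMap_mul_left g) _ hH)
    rwa [Set.image_image] at this
  choose r hrP hr using hP
  obtain ⟨t, ht⟩ := hS.elim_nhds_subcover'
    (fun A _ => (fun u => (r A * u) • stdApartment F) '' H) fun A _ =>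
      (hopen (r A)).mem_nhds ⟨1, h1, by simp [hr]⟩
  classical
  refine ⟨t.image fun A => r A.1, ?_, fun A hA => ?_⟩
  · intro g hg
    obtain ⟨A, -, rfl⟩ := Finset.mem_image.1 hg
    exact hrP _
  · obtain ⟨B, hB, u, hu, h⟩ := Set.mem_iUnion₂.1 (ht hA)
    exact ⟨r B.1, Finset.mem_image_of_mem _ hB, u, hu, h⟩

/-- As `PGL(2, F)` is locally compact and the orbit map is open, a compact set of oriented
apartments is contained in the image of a compact set. -/
theorem exists_isCompact_lift {S : Set (OrientedApartment F)} (hS : IsCompact S) :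
    ∃ C : Set PGL(2, F), IsCompact C ∧ S ⊆ (fun g => g • stdApartment F) '' C := by
  obtain ⟨t, -, ht⟩ := exists_finite_cover (P := Set.univ)
    (fun A => (exists_smul_stdApartment A).imp fun _ h => ⟨trivial, h⟩)
    (isOpen_stabilizer_vertex (stdVertex F 0)) (one_mem (MulAction.stabilizer _ _)) hS
  refine ⟨⋃ g ∈ t, (fun u => g * u) ''
    (MulAction.stabilizer PGL(2, F) (stdVertex F 0) : Set PGL(2, F)),
    t.finite_toSet.isCompact_biUnion fun g _ =>
      isCompact_stabilizer_stdVertex_zero.image (continuous_const_mul g), fun A hA => ?_⟩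
  obtain ⟨g, hg, u, hu, h⟩ := ht A hA
  exact ⟨g * u, Set.mem_biUnion hg ⟨u, hu, rfl⟩, h⟩

theorem isOpen_setOf_eq_of_isLocallyConstant {X Y : Type*} [TopologicalSpace X] {f g : X → Y}
    (hf : IsLocallyConstant f) (hg : IsLocallyConstant g) : IsOpen {x | f x = g x} := by
  have : {x | f x = g x} = ⋃ y, f ⁻¹' {y} ∩ g ⁻¹' {y} := by
    ext x
    simp [eq_comm]
  rw [this]
  exact isOpen_iUnion fun y => (hf {y}).inter (hg {y})

/-- A locally constant function on a group with support in `C * T`, where `C` is compact and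
the function is right invariant under `T`, is left invariant under an open subgroup. -/
theorem exists_open_subgroup_left_invariant {G : Type*} [Group G] [TopologicalSpace G]
    [IsTopologicalGroup G] {φ : G → ℂ} (hφ : IsLocallyConstant φ) {T : Subgroup G}
    (hT : ∀ g, ∀ t ∈ T, φ (g * t) = φ g) {C : Set G} (hC : IsCompact C)
    (hs : Function.support φ ⊆ C * (T : Set G)) :
    ∃ K : Subgroup G, IsOpen (K : Set G) ∧ ∀ κ ∈ K, ∀ g, φ (κ * g) = φ g := by
  let K : Subgroup G :=
    { carrier := {κ | ∀ g, φ (κ * g) = φ g}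
      one_mem' := fun g => by rw [one_mul]
      mul_mem' := fun {a b} ha hb g => by rw [mul_assoc, ha, hb]
      inv_mem' := fun {a} ha g => by rw [← ha, mul_inv_cancel_left] }
  refine ⟨K, ?_, fun κ hκ => hκ⟩
  have hn : IsOpen {p : G × G | φ (p.1 * p.2) = φ p.2} := by
    have h1 : IsLocallyConstant fun p : G × G => φ (p.1 * p.2) :=
      hφ.comp_continuous continuous_mul
    have h2 : IsLocallyConstant fun p : G × G => φ p.2 := hφ.comp_continuous continuous_snd
    exact isOpen_setOf_eq_of_isLocallyConstant h1 h2
  obtain ⟨U, V, hU, -, h1U, hCV, hUV⟩ := generalized_tube_lemma (isCompact_singleton (x := (1 : G)))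
    hC hn (by rintro ⟨u, c⟩ ⟨rfl, -⟩; simp)
  have hU1 : ∀ u ∈ U, ∀ g, φ g ≠ 0 → φ (u * g) = φ g := by
    intro u hu g hg
    obtain ⟨c, hc, t, ht, rfl⟩ := hs hg
    show φ (u * (c * t)) = φ (c * t)
    rw [← mul_assoc, hT _ t ht, hT _ t ht]
    exact hUV (Set.mk_mem_prod hu (hCV hc))
  refine K.isOpen_of_mem_nhds (g := 1) ?_
  have hU0 : U ∈ nhds (1 : G) := hU.mem_nhds (h1U rfl)
  filter_upwards [hU0, inv_mem_nhds_one G hU0] with u hu hu' g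
  by_cases hg : φ g = 0
  · by_contra h
    have h0 : φ (u * g) ≠ 0 := by rwa [hg] at h
    have := hU1 _ hu' _ h0
    rw [inv_mul_cancel_left] at this
    exact h this.symm
  · exact hU1 u hu g hg

theorem mem_cind_of_mem_CcApt {f : OrientedApartment F → ℂ} (hf : f ∈ CcApt F) :
    (fun g : PGL(2, F) => f (g • stdApartment F)) ∈ cind F := by
  obtain ⟨hlc, hcs⟩ := hf
  have hT : ∀ g : PGL(2, F), ∀ t ∈ torus F,
      f ((g * t) • stdApartment F) = f (g • stdApartment F) := fun g t ht => by
    rw [mul_smul, smul_stdApartment_eq_iff.2 ht]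
  obtain ⟨C, hC, hSC⟩ := exists_isCompact_lift hcs.isCompact
  have hs : Function.support (fun g : PGL(2, F) => f (g • stdApartment F)) ⊆
      C * (torus F : Set PGL(2, F)) := fun g hg => by
    obtain ⟨c, hc, e⟩ := hSC (subset_tsupport f hg)
    obtain ⟨t, ht, rfl⟩ := smul_stdApartment_eq_smul_iff.1 e.symm
    exact Set.mul_mem_mul hc ht
  exact ⟨hT, exists_open_subgroup_left_invariant (isLocallyConstant_apartment_iff.1 hlc) hT hC hs,
    C, hC, hs⟩

theorem exists_CcApt_of_mem_cind {φ : PGL(2, F) → ℂ} (hφ : φ ∈ cind F) :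
    ∃ f ∈ CcApt F, ∀ g : PGL(2, F), f (g • stdApartment F) = φ g := by
  obtain ⟨hT, ⟨K, hK, hKφ⟩, C, hC, hs⟩ := hφ
  choose r hr using exists_smul_stdApartment (F := F)
  have hf : ∀ g : PGL(2, F), φ (r (g • stdApartment F)) = φ g := fun g => by
    obtain ⟨t, ht, e⟩ := smul_stdApartment_eq_smul_iff.1 (hr (g • stdApartment F))
    rw [e, hT _ t ht]
  have hlc : IsLocallyConstant fun A => φ (r A) := by
    refine isLocallyConstant_apartment_iff.2 ((IsLocallyConstant.iff_exists_open _).2 fun g =>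
      ⟨(fun h => h * g⁻¹) ⁻¹' K, hK.preimage (continuous_mul_const _), by simp, fun h hh => ?_⟩)
    rw [hf, hf, ← hKφ _ hh g, inv_mul_cancel_right]
  refine ⟨fun A => φ (r A), ⟨hlc, hasCompactSupport_of_subset hlc (hC.image continuous_orbit)
    fun A hA => ?_⟩, hf⟩
  obtain ⟨c, hc, t, ht, e⟩ := hs hA
  refine ⟨c, hc, ?_⟩
  rw [← hr A]
  exact (smul_stdApartment_eq_smul_iff.2 ⟨t, ht, e.symm⟩).symm

variable (F) in
/-- The identification of `C_c⁰(Ã)` with the compactly induced representation. -/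
def aptEquivCind : CcApt F ≃ₗ[ℂ] cind F :=
  LinearEquiv.ofBijective
    { toFun := fun f => ⟨fun g => f.1 (g • stdApartment F), mem_cind_of_mem_CcApt f.2⟩
      map_add' := fun _ _ => rfl
      map_smul' := fun _ _ => rfl } (by
    constructor
    · intro f f' h
      refine Subtype.ext (funext fun A => ?_)
      obtain ⟨g, rfl⟩ := exists_smul_stdApartment A
      exact congrFun (congrArg Subtype.val h) g
    · rintro ⟨φ, hφ⟩
      obtain ⟨f, hf, h⟩ := exists_CcApt_of_mem_cind hφ
      exact ⟨⟨f, hf⟩, Subtype.ext (funext h)⟩)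

/-! ### Representatives of oriented apartments with columns of equal norm -/

variable (F) in
/-- The elements of `PGL(2, F)` represented by a matrix whose columns have equal norms. Then the
vertex `0` of the corresponding oriented apartment is the one closest to the class of `𝒪²` in the
tree. -/
def balanced : Set PGL(2, F) := {g | ∃ γ, pr γ = g ∧ colNorm γ 0 = colNorm γ 1}

theorem pr_mem_balanced {γ : GL (Fin 2) F} : pr γ ∈ balanced F ↔ colNorm γ 0 = colNorm γ 1 := by
  constructor
  · rintro ⟨δ, hδ, h⟩
    obtain ⟨a, ha⟩ := ProjGenLinGroup.mk_eq_mk_iff.1 hδ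
    have : γ = GeneralLinearGroup.scalar (Fin 2) a * δ := by
      rw [← ha, GeneralLinearGroup.scalar_commute]
    rw [this, colNorm_scalar_mul, colNorm_scalar_mul, h]
  · exact fun h => ⟨γ, rfl, h⟩

theorem exists_balanced (A : OrientedApartment F) : ∃ g ∈ balanced F, g • stdApartment F = A := by
  obtain ⟨g, rfl⟩ := exists_smul_stdApartment A
  induction g using Matrix.ProjGenLinGroup.induction_on with
  | mk γ =>
    have hz : ∀ j, ∃ n : ℤ, colNorm γ j = vv (unif F : F) ^ n := fun j => by
      obtain ⟨i, hi⟩ := colNorm_eq_val γ j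
      have hne : γ i j ≠ 0 := fun h => (colNorm_pos γ j).ne' (by rw [hi, h, map_zero])
      obtain ⟨n, hn⟩ := exists_val_eq_zpow (Units.mk0 _ hne)
      exact ⟨n, hi.trans hn⟩
    obtain ⟨m, hm⟩ := hz 0
    obtain ⟨n, hn⟩ := hz 1
    refine ⟨pr (γ * diag 1 (unif F ^ (m - n))), pr_mem_balanced.2 ?_, ?_⟩
    · rw [(colNorm_mul_diag _ _ _).1, (colNorm_mul_diag _ _ _).2, hm, hn, Units.val_one, map_one,
        mul_one, Units.val_zpow_eq_zpow_val, map_zpow₀, ← zpow_add₀ (by simp), add_sub_cancel]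
    · rw [map_mul, mul_smul, mk_diag_smul_stdApartment]

/-- A torus element relating two balanced elements fixes the standard apartment pointwise. -/
theorem smul_stdVertex_of_balanced {g t : PGL(2, F)} (hg : g ∈ balanced F) (ht : t ∈ torus F)
    (hgt : g * t ∈ balanced F) (n : ℤ) : t • stdVertex F n = stdVertex F n := by
  obtain ⟨a, b, rfl⟩ := mem_torus_iff.1 ht
  obtain ⟨γ, rfl, hγ⟩ := hg
  rw [← map_mul, pr_mem_balanced, (colNorm_mul_diag _ _ _).1, (colNorm_mul_diag _ _ _).2, hγ] at hgt
  have hab : vv (a : F) = vv (b : F) := mul_left_cancel₀ (colNorm_pos γ 1).ne' hgt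
  rw [mk_diag_smul (j := 0) (by rw [zpow_zero, mul_one, hab]), add_zero]

/-- A matrix with unit determinant fixing the vertices `1` and `-1` is diagonal modulo `𝔪`, so right
multiplication by it preserves the common norm of the two columns. -/
theorem mul_mem_balanced {g u : PGL(2, F)} (hg : g ∈ balanced F)
    (h1 : u • stdVertex F 1 = stdVertex F 1) (h2 : u • stdVertex F (-1) = stdVertex F (-1)) :
    g * u ∈ balanced F := by
  obtain ⟨γ, rfl, hγ⟩ := hg
  obtain ⟨υ, rfl, hd⟩ := exists_lift_of_fix h1
  obtain ⟨h00, -, h10, h11⟩ := val_entries_le_of_fix hd h1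
  obtain ⟨-, h01, -, -⟩ := val_entries_le_of_fix hd h2
  rw [zpow_one] at h10
  rw [_root_.zpow_neg_one, mul_inv_le_iff₀ (by simp [zero_lt_iff]), one_mul] at h01
  replace h10 := h10.trans_lt val_unif_lt_one
  replace h01 := h01.trans_lt val_unif_lt_one
  have hprod : 1 ≤ vv (υ 0 0) * vv (υ 1 1) := by
    rw [← map_mul]
    refine le_of_not_gt fun h => absurd hd (ne_of_lt ?_)
    rw [det_entries]
    refine (Valuation.map_sub _ _ _).trans_lt (max_lt h ?_)
    rw [map_mul]
    exact (mul_le_of_le_one_left' h01.le).trans_lt h10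
  have e00 : vv (υ 0 0) = 1 := le_antisymm h00 (hprod.trans (mul_le_of_le_one_right' h11))
  have e11 : vv (υ 1 1) = 1 := le_antisymm h11 (hprod.trans (mul_le_of_le_one_left' h00))
  -- adding a short vector to a vector does not change its norm
  have key : ∀ (δ : GL (Fin 2) F) (j l l' : Fin 2) (x y : F), vv x = 1 → vv y < 1 →
      colNorm γ l' = colNorm γ l → (∀ i, δ i j = γ i l * x + γ i l' * y) →
      colNorm δ j = colNorm γ l := by
    intro δ j l l' x y hx hy hll hδ
    have hs : ∀ i, vv (γ i l' * y) < colNorm γ l := fun i => by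
      rw [map_mul]
      calc vv (γ i l') * vv y ≤ colNorm γ l * vv y :=
            mul_le_mul_left (hll ▸ val_le_colNorm γ i l') _
        _ < colNorm γ l := mul_lt_of_lt_one_right (colNorm_pos γ l) hy
    refine le_antisymm ?_ ?_
    · have : ∀ i, vv (δ i j) ≤ colNorm γ l := fun i => by
        rw [hδ]
        refine Valuation.map_add_le _ ?_ (hs i).le
        rw [map_mul, hx, mul_one]
        exact val_le_colNorm _ _ _
      exact max_le (this 0) (this 1)
    · obtain ⟨i, hi⟩ := colNorm_eq_val γ l
      have hi' : vv (γ i l * x) = colNorm γ l := by rw [map_mul, hx, mul_one, hi]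
      have : vv (δ i j) = colNorm γ l := by
        rw [hδ, Valuation.map_add_eq_of_lt_left _ (hi'.symm ▸ hs i), hi']
      rw [← this]
      exact val_le_colNorm _ _ _
  rw [← map_mul, pr_mem_balanced]
  have c0 := key (γ * υ) 0 0 1 _ _ e00 h10 hγ.symm fun i => by
    simp [Matrix.mul_apply, Fin.sum_univ_two]
  have c1 := key (γ * υ) 1 1 0 _ _ e11 h01 hγ fun i => by
    simp [Matrix.mul_apply, Fin.sum_univ_two, add_comm]
  rw [c0, c1, hγ]

/-! ### Surjectivity -/

theorem continuous_upper : Continuous (upper : F → GL (Fin 2) F) := by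
  refine Units.continuous_iff.2 ⟨continuous_matrix fun i j => ?_, continuous_matrix fun i j => ?_⟩
  · fin_cases i <;> fin_cases j <;> simp <;> fun_prop
  · fin_cases i <;> fin_cases j <;> simp [← upper_neg] <;> fun_prop

theorem continuous_lower : Continuous (lower : F → GL (Fin 2) F) := by
  have h : ∀ y : F, (lower y)⁻¹ = lower (-y) := fun _ => Units.ext rfl
  refine Units.continuous_iff.2 ⟨continuous_matrix fun i j => ?_, continuous_matrix fun i j => ?_⟩
  · fin_cases i <;> fin_cases j <;> simp <;> fun_prop
  · fin_cases i <;> fin_cases j <;> simp [h] <;> fun_prop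

theorem exists_val_le_zpow_subset {U : Set F} (hU : U ∈ nhds (0 : F)) :
    ∃ n : ℤ, {x : F | vv x ≤ vv (unif F : F) ^ n} ⊆ U := by
  obtain ⟨r, hr, hrU⟩ := (IsValuativeTopology.hasBasis_nhds_zero' F).mem_iff.1 hU
  obtain ⟨x, rfl⟩ := ValuativeRel.valuation_surjective r
  obtain ⟨j, hj⟩ := exists_val_eq_zpow (Units.mk0 x (by simpa using hr))
  rw [Units.val_mk0] at hj
  refine ⟨j + 1, fun y hy => hrU ?_⟩
  refine lt_of_le_of_lt (show vv y ≤ _ from hy) ?_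
  rw [hj, lt_iff_not_ge, val_zpow_le_iff]
  omega

/-- A locally constant function that is right invariant under the torus is, near a compact set,
right invariant under the pointwise stabilizer of a long enough segment of the standard
apartment: by the Gauss decomposition, such a stabilizer is the product of a subgroup of the torus
and of unipotent matrices close to the identity. -/
theorem exists_right_invariant {φ : PGL(2, F) → ℂ} (hφ : IsLocallyConstant φ)
    (hT : ∀ g, ∀ t ∈ torus F, φ (g * t) = φ g) {C : Set PGL(2, F)} (hC : IsCompact C) :
    ∃ m : ℕ, ∀ c ∈ C, ∀ u : PGL(2, F),
      u • stdVertex F (m + 1) = stdVertex F (m + 1) →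
      u • stdVertex F (-(m + 1)) = stdVertex F (-(m + 1)) → φ (c * u) = φ c := by
  have hn : IsOpen {p : PGL(2, F) × (F × F) |
      φ (p.1 * (pr (upper p.2.1) * pr (lower p.2.2))) = φ p.1} := by
    have hc : Continuous fun p : PGL(2, F) × (F × F) =>
        p.1 * (pr (upper p.2.1) * pr (lower p.2.2)) :=
      continuous_fst.mul (((continuous_pr.comp continuous_upper).comp
        (continuous_fst.comp continuous_snd)).mul ((continuous_pr.comp continuous_lower).comp
          (continuous_snd.comp continuous_snd)))
    exact isOpen_setOf_eq_of_isLocallyConstant (hφ.comp_continuous hc)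
      (hφ.comp_continuous continuous_fst)
  obtain ⟨U, V, -, hV, hCU, h0V, hUV⟩ := generalized_tube_lemma hC
    (isCompact_singleton (x := ((0, 0) : F × F))) hn (by
      rintro ⟨c, x⟩ ⟨-, rfl⟩
      simp [upper_zero, lower_zero])
  have hV0 : V ∈ nhds (0 : F) ×ˢ nhds (0 : F) := by
    rw [← nhds_prod_eq]
    exact hV.mem_nhds (h0V rfl)
  obtain ⟨V₁, hV₁, V₂, hV₂, hVV⟩ := Filter.mem_prod_iff.1 hV0
  obtain ⟨n₁, h₁⟩ := exists_val_le_zpow_subset hV₁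
  obtain ⟨n₂, h₂⟩ := exists_val_le_zpow_subset hV₂
  refine ⟨n₁.toNat + n₂.toNat, fun c hc u hu1 hu2 => ?_⟩
  set m : ℕ := n₁.toNat + n₂.toNat
  obtain ⟨υ, rfl, hd⟩ := exists_lift_of_fix hu1
  obtain ⟨h00, -, h10, h11⟩ := val_entries_le_of_fix hd hu1
  obtain ⟨-, h01, -, -⟩ := val_entries_le_of_fix hd hu2
  rw [_root_.zpow_neg, mul_inv_le_iff₀ (val_unif_pos _), one_mul] at h01
  have hq : vv (unif F : F) ^ ((m : ℤ) + 1) < 1 := by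
    rw [← zpow_zero (vv (unif F : F)), lt_iff_not_ge, val_zpow_le_iff]
    omega
  have e11 : vv (υ 1 1) = 1 := by
    refine le_antisymm h11 (le_of_not_gt fun h => absurd hd (ne_of_lt ?_))
    rw [det_entries]
    refine (Valuation.map_sub _ _ _).trans_lt (max_lt ?_ ?_) <;> rw [map_mul]
    · exact (mul_le_of_le_one_left' h00).trans_lt h
    · exact (mul_le_of_le_one_left' (h01.trans hq.le)).trans_lt (h10.trans_lt hq)
  have hne : υ 1 1 ≠ 0 := by
    intro h
    simp [h] at e11
  have hdiag : ∀ (x y : PGL(2, F)) (a b : Fˣ), φ (x * (y * pr (diag a b))) = φ (x * y) :=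
    fun x y a b => by
      rw [← mul_assoc]
      exact hT _ _ (mem_torus_iff.2 ⟨a, b, rfl⟩)
  have key : ∀ x y : F, vv x ≤ vv (unif F : F) ^ n₁ → vv y ≤ vv (unif F : F) ^ n₂ →
      φ (c * (pr (upper x) * pr (lower y))) = φ c := fun x y hx hy => by
    have hxy : ((x, y) : F × F) ∈ V := hVV (Set.mk_mem_prod (h₁ hx) (h₂ hy))
    have h := hUV (Set.mk_mem_prod (hCU hc) hxy)
    rwa [Set.mem_ofPred_eq] at h
  have hυ := congrArg pr (gauss_decomposition υ (Units.mk0 _ hne) rfl)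
  rw [map_mul, map_mul, ← mul_assoc] at hυ
  refine (congrArg (fun u => φ (c * u)) hυ).trans ((hdiag c _ _ _).trans (key _ _ ?_ ?_))
  · rw [map_mul, map_inv₀, Units.val_mk0, e11, inv_one, mul_one]
    exact h01.trans (val_zpow_le_iff.2 (by omega))
  · rw [map_mul, map_mul, map_inv₀, Units.val_mk0, e11, hd, inv_one, mul_one, mul_one]
    exact h10.trans (val_zpow_le_iff.2 (by omega))

/-- The oriented apartments in a compact set have their balanced representatives in a compact
set of balanced elements. -/
theorem exists_isCompact_balanced {S : Set (OrientedApartment F)} (hS : IsCompact S) :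
    ∃ C : Set PGL(2, F), IsCompact C ∧ ∀ g ∈ balanced F, g • stdApartment F ∈ S → g ∈ C := by
  let H : Set PGL(2, F) := MulAction.stabilizer PGL(2, F) (stdPath F 2 (-1))
  have hfix : ∀ u ∈ H, ∀ n : ℤ, -1 ≤ n → n ≤ 1 → u • stdVertex F n = stdVertex F n :=
    fun u hu n h1 h2 => smul_stdVertex_of_smul_stdPath hu h1 (by push_cast; omega)
  have hHc : IsCompact H := isCompact_stabilizer_stdVertex_zero.of_isClosed_subset
    (Subgroup.isClosed_of_isOpen _ (isOpen_stabilizer_path _))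
    fun u hu => hfix u hu 0 (by omega) (by omega)
  obtain ⟨t, htP, ht⟩ := exists_finite_cover exists_balanced
    (isOpen_stabilizer_path (stdPath F 2 (-1))) (one_mem (MulAction.stabilizer _ _)) hS
  refine ⟨⋃ g ∈ t, (fun u => g * u) '' H, t.finite_toSet.isCompact_biUnion fun g _ =>
    hHc.image (continuous_const_mul g), fun g hg hgS => ?_⟩
  obtain ⟨h, hh, u, hu, e⟩ := ht _ hgS
  obtain ⟨τ, hτ, rfl⟩ := smul_stdApartment_eq_smul_iff.1 e.symm
  have hhu : h * u ∈ balanced F := mul_mem_balanced (htP hh) (hfix u hu 1 (by omega) le_rfl)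
    (hfix u hu (-1) le_rfl (by omega))
  have hτH : τ ∈ H := smul_stdPath_eq fun n _ _ => smul_stdVertex_of_balanced hhu hτ hg n
  exact Set.mem_biUnion hh ⟨u * τ, mul_mem (S := Subgroup PGL(2, F)) hu hτH, (mul_assoc _ _ _).symm⟩

/-- Every locally constant function with compact support on the space of oriented apartments is
a Radon transform. -/
theorem exists_radon_eq {f : OrientedApartment F → ℂ} (hf : f ∈ CcApt F) :
    ∃ (k : ℕ) (ω : Cc1 F k), radon F k ω = f := by
  obtain ⟨hlc, hcs⟩ := hf
  obtain ⟨C, hC, hSC⟩ := exists_isCompact_balanced hcs.isCompact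
  obtain ⟨m, hm⟩ := exists_right_invariant (isLocallyConstant_apartment_iff.1 hlc)
    (fun g t ht => by rw [mul_smul, smul_stdApartment_eq_iff.2 ht]) hC
  have hCf : ∀ g ∈ balanced F, f (g • stdApartment F) ≠ 0 → g ∈ C := fun g hg h =>
    hSC g hg (subset_tsupport f h)
  let p : KPath F (2 * m + 1 + 1) := stdPath F (2 * m + 1 + 1) (-(m + 1))
  have hfix : ∀ u : PGL(2, F), u • p = p → ∀ n : ℤ, -(m + 1) ≤ n → n ≤ m + 1 →
      u • stdVertex F n = stdVertex F n := fun u hu n h1 h2 =>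
    smul_stdVertex_of_smul_stdPath hu h1 (by push_cast; omega)
  have hbal : ∀ g ∈ balanced F, ∀ u : PGL(2, F), u • p = p → g * u ∈ balanced F :=
    fun g hg u hu => mul_mem_balanced hg (hfix u hu 1 (by omega) (by omega))
      (hfix u hu (-1) (by omega) (by omega))
  have hinvC : ∀ g ∈ C, ∀ u : PGL(2, F), u • p = p →
      f ((g * u) • stdApartment F) = f (g • stdApartment F) := fun g hg u hu =>
    hm g hg u (hfix u hu _ (by omega) le_rfl) (hfix u hu _ le_rfl (by omega))
  have hinv : ∀ g ∈ balanced F, ∀ u : PGL(2, F), u • p = p →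
      f ((g * u) • stdApartment F) = f (g • stdApartment F) := by
    intro g hg u hu
    by_contra h
    have hu' : u⁻¹ • p = p := inv_smul_eq_iff.2 hu.symm
    have hg0 : g ∉ C := fun hgC => h (hinvC g hgC u hu)
    have hgu : g * u ∉ C := fun hgC => h (by
      have := hinvC _ hgC u⁻¹ hu'
      rw [mul_inv_cancel_right] at this
      exact this.symm)
    refine h (Eq.trans (b := 0) ?_ (Eq.symm ?_))
    · exact not_not.1 fun h' => hgu (hCf _ (hbal g hg u hu) h')
    · exact not_not.1 fun h' => hg0 (hCf _ hg h')
  -- the cochain supported on the segments from `-(m + 1)` to `m + 1` of the apartments of balanced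
  -- elements
  classical
  let w : KPath F (2 * m + 1 + 1) → ℂ := fun a =>
    if h : ∃ g ∈ balanced F, g • p = a then f (h.choose • stdApartment F) else 0
  have hw : ∀ g ∈ balanced F, w (g • p) = f (g • stdApartment F) := by
    intro g hg
    have h : ∃ g' ∈ balanced F, g' • p = g • p := ⟨g, hg, rfl⟩
    have := hinv g hg (g⁻¹ * h.choose) (by rw [mul_smul, h.choose_spec.2, inv_smul_smul])
    rw [mul_inv_cancel_left] at this
    rw [← this]
    exact dif_pos h
  have hw' : ∀ a, w a ≠ 0 → ∃ g ∈ balanced F, g • p = a := fun a ha => by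
    by_contra h
    exact ha (dif_neg h)
  have hfin : (Function.support w).Finite := by
    refine (finite_image_of_isCompact (isLocallyConstant_smul_path p) hC).subset fun a ha => ?_
    obtain ⟨g, hg, rfl⟩ := hw' a ha
    have ha : w (g • p) ≠ 0 := ha
    rw [hw g hg] at ha
    exact ⟨g, hCf g hg ha, rfl⟩
  refine ⟨2 * m + 1, Finsupp.ofSupportFinite w hfin, funext fun A => ?_⟩
  obtain ⟨g, hg, rfl⟩ := exists_balanced A
  rw [radon_smul_stdApartment, finsum_eq_single _ (-((m : ℤ) + 1))]
  · exact hw g hg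
  · intro n hn
    by_contra h
    obtain ⟨g', hg', e⟩ := hw' _ h
    have hp : stdPath F (2 * m + 1 + 1) n = shift F (n + (m + 1)) • p := by
      rw [shift_smul_stdPath]
      congr 1
      ring
    have hb := hbal g' hg' (g'⁻¹ * (g * shift F (n + (m + 1)))) (by
      rw [mul_smul, mul_smul, ← hp, ← e, inv_smul_smul])
    rw [mul_inv_cancel_left] at hb
    have := smul_stdVertex_of_balanced hg (mem_torus_iff.2 ⟨_, _, rfl⟩) hb 0
    have := stdVertex_injective ((shift_smul _ _).symm.trans this)
    omega

end Vertices

end BTTree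
end

open BTTree
theorem mainTheorem3 (F : Type*) [Field F] [ValuativeRel F] [TopologicalSpace F]
    [IsNonarchimedeanLocalField F] :
    ∃ (R : ∀ k : ℕ, Cc1 F k →ₗ[ℂ] CcApt F) (Rbar : ∀ k : ℕ, Hc1 F k →ₗ[ℂ] CcApt F)
      (e : CcApt F ≃ₗ[ℂ] cind F),
      -- `R k` is the Radon transform, `Rbar k` is the map it induces on cohomology,
      -- `e` is the identification of `C_c⁰(Ã)` with `cind_T^G 1_T`
      (∀ k ω, (R k ω : OrientedApartment F → ℂ) = radon F k ω) ∧
      (∀ k ω, Rbar k (Hc1.mk F k ω) = R k ω) ∧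
      (∀ (f : CcApt F) (g : PGL(2, F)),
        (e f : PGL(2, F) → ℂ) g = (f : OrientedApartment F → ℂ) (g • stdApartment F)) ∧
      -- equivariance
      (∀ k (g : PGL(2, F)) f,
        coboundary F k (pathRep F k g f) = pathRep F (k + 1) g (coboundary F k f)) ∧
      (∀ k (g : PGL(2, F)) ω, R k (pathRep F (k + 1) g ω) = aptRep F g (R k ω)) ∧
      (∀ k (g : PGL(2, F)) c, Rbar k (hc1Rep F k g c) = aptRep F g (Rbar k c)) ∧
      (∀ (g : PGL(2, F)) f, e (aptRep F g f) = cindRep F g (e f)) ∧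
      -- (a)
      (∀ k, Function.Exact (coboundary F k) (R k)) ∧
      (∀ k, Function.Injective (Rbar k)) ∧
      -- (b)
      (⋃ k, Set.range (Rbar k)) = Set.univ := by
  let R : ∀ k : ℕ, Cc1 F k →ₗ[ℂ] CcApt F := fun k =>
    { toFun := fun ω => ⟨radon F k ω, radon_mem_CcApt ω⟩
      map_add' := fun ω η => Subtype.ext (map_add (radon F k) ω η)
      map_smul' := fun c ω => Subtype.ext (map_smul (radon F k) c ω) }
  have hR0 : ∀ k ω, R k ω = 0 ↔ ω ∈ Set.range (coboundary F k) := fun k ω =>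
    Subtype.ext_iff.trans radon_eq_zero_iff
  have hRrep : ∀ k (g : PGL(2, F)) ω, R k (pathRep F (k + 1) g ω) = aptRep F g (R k ω) :=
    fun k g ω => Subtype.ext (funext fun A => radon_pathRep g ω A)
  let Rbar : ∀ k : ℕ, Hc1 F k →ₗ[ℂ] CcApt F := fun k =>
    (LinearMap.range (coboundary F k)).liftQ (R k) fun ω hω => (hR0 k ω).2 hω
  refine ⟨R, Rbar, aptEquivCind F, fun _ _ => rfl, fun _ _ => rfl, fun _ _ => rfl,
    fun _ => coboundary_pathRep, hRrep, fun k g c => ?_, fun g f => ?_, hR0, fun k => ?_, ?_⟩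
  · obtain ⟨ω, rfl⟩ := Submodule.mkQ_surjective _ c
    exact hRrep k g ω
  · refine Subtype.ext (funext fun h => ?_)
    show f.1 (g⁻¹ • h • stdApartment F) = f.1 ((g⁻¹ * h) • stdApartment F)
    rw [mul_smul]
  · refine (injective_iff_map_eq_zero _).2 fun c hc => ?_
    obtain ⟨ω, rfl⟩ := Submodule.mkQ_surjective _ c
    exact (Submodule.Quotient.mk_eq_zero _).2 ((hR0 k ω).1 hc)
  · refine Set.eq_univ_of_forall fun f => ?_
    obtain ⟨k, ω, h⟩ := exists_radon_eq f.2
    exact Set.mem_iUnion.2 ⟨k, Hc1.mk F k ω, Subtype.ext h⟩
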